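/- All spaces are over $\mathbb{C}$. Let $\mathrm{QSym}$ be the graded Hopf algebra of quasisymmetric functions in $x_1,x_2,\dots$ (the product is that of power series, and the coproduct is deconcatenation in the monomial basis $M_\alpha$), let $\mathrm{Sym}\subseteq\mathrm{QSym}$ be the Hopf subalgebra of symmetric functions, and let $p_n=\frac1n\sum_i x_i^n$ for $n\ge 1$. Let $\zeta_{\mathrm{QSym}}(f)=f(1,0,0,\dots)$ and $\zeta_{\mathrm{Sym}}=\zeta_{\mathrm{QSym}}|_{\mathrm{Sym}}$. A combinatorial Hopf algebra is a graded connected Hopf algebra $\mathsf H$ with a character (algebra morphism) $\zeta:\mathsf H\to\mathbb C$; a morphism $(\mathsf H,\zeta)\to(\mathsf H',\zeta')$ is a graded Hopf morphism $\Phi$ with $\zeta'\circ\Phi=\zeta$. Characters form a group under convolution, and $\overline{\zeta}$ denotes the character equal to $(-1)^n\zeta$ in degree $n$. Let $\Theta_{\mathrm{QSym}}$ be the unique morphism $(\mathrm{QSym},\overline{\zeta_{\mathrm{QSym}}^{-1}}\,\zeta_{\mathrm{QSym}})\to(\mathrm{QSym},\zeta_{\mathrm{QSym}})$ of combinatorial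 Hopf algebras, let $\Theta_{\mathrm{Sym}}$ be the unique morphism $(\mathrm{Sym},\overline{\zeta_{\mathrm{Sym}}^{-1}}\,\zeta_{\mathrm{Sym}})\to(\mathrm{Sym},\zeta_{\mathrm{Sym}})$, and let $\Omega=\Theta_{\mathrm{Sym}}(\mathrm{Sym})$. A theta map for a combinatorial Hopf algebra $(\mathsf H,\zeta)$ is a linear map $\Theta:\mathsf H\to\mathsf H$ with $\Phi\circ\Theta=\Theta_{\mathrm{QSym}}\circ\Phi$, where $\Phi:(\mathsf H,\zeta)\to(\mathrm{QSym},\zeta_{\mathrm{QSym}})$ is the unique morphism of combinatorial Hopf algebras; the image of $\Theta$ is then called a peak algebra for $(\mathsf H,\zeta)$. Let $V$ be a graded vector space with a homogeneous basis $(v_i)_{i\in I}$ such that for every $n$ only finitely many words $v_{i_1}\cdots v_{i_\ell}$ ($\ell\ge 0$) have degree $\deg v_{i_1}+\cdots+\deg v_{i_\ell}=n$ (in particular $\deg v_i\ge 1$). Let $\mathrm T(V)$ be the tensor algebra, graded by this degree of words, with the Hopf algebra structure for which every $v_i$ is primitive. Let $\mathrm O(V)\subseteq V$ be the span of the $v_i$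 of odd degree. Let $\Phi_{\mathrm T(V)}:\mathrm T(V)\to\mathrm{Sym}$ be the algebra morphism with $\Phi_{\mathrm T(V)}(v_i)=p_{\deg v_i}$, and let $\zeta_{\mathrm T(V)}=\zeta_{\mathrm{Sym}}\circ\Phi_{\mathrm T(V)}$. Let $\Theta_{\mathrm T(V)}:\mathrm T(V)\to\mathrm T(V)$ be the linear map with $$\Theta_{\mathrm T(V)}(v_{i_1}\cdots v_{i_\ell})=\begin{cases}2^{\ell}\,v_{i_1}\cdots v_{i_\ell}&\text{if all }\deg v_{i_j}\text{ are odd},\\0&\text{otherwise.}\end{cases}$$ Theorem. The map $\Phi_{\mathrm T(V)}$ is a graded Hopf morphism. The map $\Theta_{\mathrm T(V)}$ is a graded Hopf morphism, its image is $\mathrm T(\mathrm O(V))$, and $\Phi_{\mathrm T(V)}\circ\Theta_{\mathrm T(V)}=\Theta_{\mathrm{Sym}}\circ\Phi_{\mathrm T(V)}$; in particular $\Phi_{\mathrm T(V)}$ maps $\mathrm T(\mathrm O(V))$ into $\Omega$. Here $\Theta_{\mathrm{Sym}}$, $\Theta_{\mathrm{QSym}}$ and the morphism $\Phi:(\mathrm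 T(V),\zeta_{\mathrm T(V)})\to(\mathrm{QSym},\zeta_{\mathrm{QSym}})$ exist and are unique, and $\mathrm T(V)$ is a graded connected Hopf algebra. So $\Theta_{\mathrm T(V)}$ is a theta map for $(\mathrm T(V),\zeta_{\mathrm T(V)})$, with peak algebra $\mathrm T(\mathrm O(V))$. -/

import Mathlib

noncomputable section

namespace PeakAlgebra

open scoped TensorProduct
open MvPowerSeries (coeff)

/-! ### Series in the variables `x₀, x₁, x₂, …` invariant under a class of reindexings -/

/-- The complex power series `f` in `x₀, x₁, x₂, …` which have bounded degree and whose coefficients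
are invariant under the reindexings `φ ∈ S` of the variables: the coefficient of
`x_{i₁}^{a₁} ⋯ x_{iₖ}^{aₖ}` is that of `x_{φ i₁}^{a₁} ⋯ x_{φ iₖ}^{aₖ}`. -/
def invSeries (S : Set (ℕ ↪ ℕ)) : Subalgebra ℂ (MvPowerSeries ℕ ℂ) where
  carrier := {f | (∃ d, ∀ m : ℕ →₀ ℕ, d < m.degree → coeff m f = 0) ∧
    ∀ φ ∈ S, ∀ m : ℕ →₀ ℕ, coeff (m.embDomain φ) f = coeff m f}
  mul_mem' := by
    rintro f g ⟨⟨d, hd⟩, hf⟩ ⟨⟨e, he⟩, hg⟩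
    refine ⟨⟨d + e, fun m hm => ?_⟩, fun φ hφ m => ?_⟩
    · rw [MvPowerSeries.coeff_mul]
      refine Finset.sum_eq_zero fun p hp => ?_
      have h : p.1.degree + p.2.degree = m.degree := by
        rw [← map_add, Finset.HasAntidiagonal.mem_antidiagonal.mp hp]
      rcases lt_or_ge d p.1.degree with h1 | h1
      · rw [hd _ h1, zero_mul]
      · rw [he p.2 (by omega), mul_zero]
    · rw [MvPowerSeries.coeff_mul, MvPowerSeries.coeff_mul,
        ← Finsupp.image_prodMap_embDomain_antidiagonal, Finset.sum_image]
      · exact Finset.sum_congr rfl fun p _ => by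
          simp only [Prod.map_fst, Prod.map_snd]; rw [hf φ hφ, hg φ hφ]
      · exact fun _ _ _ _ h => (Function.Injective.prodMap (Finsupp.embDomain_injective φ)
          (Finsupp.embDomain_injective φ)) h
  add_mem' := by
    rintro f g ⟨⟨d, hd⟩, hf⟩ ⟨⟨e, he⟩, hg⟩
    refine ⟨⟨max d e, fun m hm => ?_⟩, fun φ hφ m => ?_⟩
    · rw [map_add, hd _ (lt_of_le_of_lt (le_max_left _ _) hm),
        he _ (lt_of_le_of_lt (le_max_right _ _) hm), add_zero]
    · rw [map_add, map_add, hf φ hφ, hg φ hφ]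
  algebraMap_mem' := by
    intro r
    refine ⟨⟨0, fun m hm => ?_⟩, fun φ _ m => ?_⟩
    · rw [MvPowerSeries.algebraMap_apply, MvPowerSeries.coeff_C, if_neg]
      rintro rfl
      simp at hm
    · rw [MvPowerSeries.algebraMap_apply, MvPowerSeries.coeff_C, MvPowerSeries.coeff_C]
      simp only [Finsupp.embDomain_eq_zero]

section Series

variable {S : Set (ℕ ↪ ℕ)}

/-- The coefficient of the monomial with exponent `m`. -/
def cf (m : ℕ →₀ ℕ) : invSeries S →ₗ[ℂ] ℂ :=
  (coeff m) ∘ₗ (invSeries S).val.toLinearMap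

theorem cf_apply (m : ℕ →₀ ℕ) (f : invSeries S) : cf m f = coeff m (f : MvPowerSeries ℕ ℂ) := rfl

theorem invSeries_ext {f g : invSeries S} (h : ∀ m, cf m f = cf m g) : f = g :=
  Subtype.ext (MvPowerSeries.ext h)

theorem cf_mul (m : ℕ →₀ ℕ) (f g : invSeries S) :
    cf m (f * g) = ∑ p ∈ Finset.HasAntidiagonal.antidiagonal m, cf p.1 f * cf p.2 g :=
  MvPowerSeries.coeff_mul _ _ _

theorem cf_one (m : ℕ →₀ ℕ) : cf m (1 : invSeries S) = if m = 0 then 1 else 0 := by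
  classical
  exact (MvPowerSeries.coeff_one (R := ℂ) (σ := ℕ) m).trans (by split_ifs <;> rfl)

/-- The homogeneous component of degree `n`. -/
def homogeneous (S : Set (ℕ ↪ ℕ)) (n : ℕ) : Submodule ℂ (invSeries S) where
  carrier := {f | ∀ m : ℕ →₀ ℕ, m.degree ≠ n → cf m f = 0}
  add_mem' := fun hf hg m hm => by rw [map_add, hf m hm, hg m hm, add_zero]
  zero_mem' := fun m _ => map_zero _
  smul_mem' := fun c f hf m hm => by rw [map_smul, hf m hm, smul_zero]

/-- The univariate polynomial `f(X, 0, 0, …)`. -/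
def toPolyFun (f : invSeries S) : Polynomial ℂ :=
  ⟨⟨Finsupp.ofSupportFinite (fun n => cf (Finsupp.single 0 n) f) (by
    obtain ⟨d, hd⟩ := f.2.1
    refine (Set.finite_Iic d).subset fun n hn => ?_
    by_contra hlt
    exact hn (hd _ (by simpa using hlt)))⟩⟩

theorem coeff_toPolyFun (f : invSeries S) (n : ℕ) :
    (toPolyFun f).coeff n = cf (Finsupp.single 0 n) f := rfl

/-- The specialization `f ↦ f(X, 0, 0, …)` as a homomorphism of algebras. -/
def toPoly : invSeries S →ₐ[ℂ] Polynomial ℂ :=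
  AlgHom.ofLinearMap
    { toFun := toPolyFun
      map_add' := fun f g => by
        ext n
        simp [coeff_toPolyFun]
      map_smul' := fun c f => by
        ext n
        simp [coeff_toPolyFun] }
    (by
      ext n
      simp [coeff_toPolyFun, cf_one, Polynomial.coeff_one])
    (fun f g => by
      ext n
      rw [Polynomial.coeff_mul]
      simp [coeff_toPolyFun, cf_mul, Finsupp.antidiagonal_single])

/-- The algebra automorphism `f(x₀, x₁, …) ↦ f(-x₀, -x₁, …)`, which acts on the homogeneous
component of degree `n` as `(-1) ^ n`. -/
def signHom : invSeries S →ₐ[ℂ] invSeries S :=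
  AlgHom.ofLinearMap
    { toFun := fun f => ⟨fun m => (-1) ^ m.degree * cf m f, by
        obtain ⟨⟨d, hd⟩, hf⟩ := f.2
        refine ⟨⟨d, fun m hm => ?_⟩, fun φ hφ m => ?_⟩
        · change (-1) ^ m.degree * coeff m (f : MvPowerSeries ℕ ℂ) = 0
          rw [hd m hm, mul_zero]
        · change (-1) ^ (m.embDomain φ).degree * coeff (m.embDomain φ) (f : MvPowerSeries ℕ ℂ) =
            (-1) ^ m.degree * coeff m (f : MvPowerSeries ℕ ℂ)
          rw [hf φ hφ, Finsupp.embDomain_eq_mapDomain, Finsupp.degree_mapDomain]⟩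
      map_add' := fun f g => invSeries_ext fun m => by
        change (-1) ^ m.degree * cf m (f + g) = (-1) ^ m.degree * cf m f + (-1) ^ m.degree * cf m g
        rw [map_add, mul_add]
      map_smul' := fun c f => invSeries_ext fun m => by
        change (-1) ^ m.degree * cf m (c • f) = c * ((-1) ^ m.degree * cf m f)
        rw [map_smul, smul_eq_mul]; ring }
    (invSeries_ext fun m => by
      change (-1) ^ m.degree * cf m (1 : invSeries S) = cf m (1 : invSeries S)
      rw [cf_one]
      split_ifs with h <;> simp [h])
    (fun f g => invSeries_ext fun m => by
      rw [cf_mul]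
      change (-1) ^ m.degree * cf m (f * g) = ∑ p ∈ Finset.HasAntidiagonal.antidiagonal m,
        ((-1) ^ p.1.degree * cf p.1 f) * ((-1) ^ p.2.degree * cf p.2 g)
      rw [cf_mul, Finset.mul_sum]
      refine Finset.sum_congr rfl fun p hp => ?_
      rw [← Finset.HasAntidiagonal.mem_antidiagonal.mp hp, map_add, pow_add]
      ring)

theorem cf_signHom (m : ℕ →₀ ℕ) (f : invSeries S) :
    cf m (signHom f) = (-1) ^ m.degree * cf m f := rfl

theorem signHom_of_homogeneous {n : ℕ} {f : invSeries S} (hf : f ∈ homogeneous S n) :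
    signHom f = (-1 : ℂ) ^ n • f := by
  refine invSeries_ext fun m => ?_
  rw [cf_signHom, map_smul, smul_eq_mul]
  rcases eq_or_ne m.degree n with h | h
  · rw [h]
  · rw [hf m h, mul_zero, mul_zero]

/-! ### The Hopf algebra structure -/

/-- The exponent of `x^m y^{m'}`, where the alphabet `y` is placed after the first `N` variables. -/
def join (N : ℕ) (m m' : ℕ →₀ ℕ) : ℕ →₀ ℕ := m + m'.embDomain (addRightEmbedding N)

/-- Data describing the orbits of exponents under the reindexings in `S` by elements `typ m` of an
additive monoid `I`, whose addition corresponds to the juxtaposition of two alphabets. -/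
structure TypeData (S : Set (ℕ ↪ ℕ)) (I : Type) [AddMonoid I] where
  typ : (ℕ →₀ ℕ) → I
  rep : I → (ℕ →₀ ℕ)
  wt : I →+ ℕ
  typ_rep : ∀ i, typ (rep i) = i
  typ_embDomain : ∀ φ ∈ S, ∀ m, typ (m.embDomain φ) = typ m
  exists_common : ∀ m m', typ m = typ m' →
    ∃ φ ∈ S, ∃ ψ ∈ S, ∃ p : ℕ →₀ ℕ, m = p.embDomain φ ∧ m' = p.embDomain ψ
  typ_join : ∀ N m m', (∀ j ∈ m.support, j < N) → typ (join N m m') = typ m + typ m'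
  wt_typ : ∀ m, wt (typ m) = m.degree
  finite_wt_le : ∀ d, {i | wt i ≤ d}.Finite

theorem sum_antidiagonal_join (N : ℕ) (m m' : ℕ →₀ ℕ) (hm : ∀ j ∈ m.support, j < N)
    (F : (ℕ →₀ ℕ) → (ℕ →₀ ℕ) → ℂ) :
    ∑ p ∈ Finset.HasAntidiagonal.antidiagonal (join N m m'), F p.1 p.2 =
      ∑ a ∈ Finset.HasAntidiagonal.antidiagonal m, ∑ b ∈ Finset.HasAntidiagonal.antidiagonal m',
        F (join N a.1 b.1) (join N a.2 b.2) := by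
  have hinj : Function.Injective (addRightEmbedding N : ℕ → ℕ) := (addRightEmbedding N).injective
  have hlt : ∀ (x : ℕ →₀ ℕ) (j : ℕ), j < N → x.embDomain (addRightEmbedding N) j = 0 := by
    intro x j hj
    apply Finsupp.embDomain_of_notMem_range
    rintro ⟨k, hk⟩
    simp at hk
    omega
  have hshift : ∀ (x : ℕ →₀ ℕ) (j : ℕ), x.embDomain (addRightEmbedding N) (j + N) = x j :=
    fun x j => Finsupp.embDomain_apply_self (addRightEmbedding N) x j
  have hm0 : ∀ j, N ≤ j → m j = 0 := fun j hj => by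
    by_contra h
    exact absurd (hm j (Finsupp.mem_support_iff.mpr h)) (by omega)
  rw [← Finset.sum_product']
  symm
  refine Finset.sum_nbij' (fun q => (join N q.1.1 q.2.1, join N q.1.2 q.2.2))
    (fun p => ((p.1.filter (· < N), p.2.filter (· < N)),
      (p.1.comapDomain (addRightEmbedding N) hinj.injOn,
        p.2.comapDomain (addRightEmbedding N) hinj.injOn))) ?_ ?_ ?_ ?_ ?_
  · rintro ⟨⟨a, a'⟩, ⟨b, b'⟩⟩ h
    simp only [Finset.mem_product, Finset.HasAntidiagonal.mem_antidiagonal] at h ⊢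
    rw [← h.1, ← h.2]
    simp only [join, Finsupp.embDomain_add]
    abel
  · rintro ⟨x, y⟩ h
    simp only [Finset.mem_product, Finset.HasAntidiagonal.mem_antidiagonal] at h ⊢
    have hj : ∀ j, x j + y j = m j + m'.embDomain (addRightEmbedding N) j := fun j => by
      rw [← Finsupp.add_apply, h]; rfl
    refine ⟨?_, ?_⟩
    · ext j
      rw [Finsupp.add_apply, Finsupp.filter_apply, Finsupp.filter_apply]
      by_cases hlN : j < N
      · rw [if_pos hlN, if_pos hlN, hj, hlt _ _ hlN, add_zero]
      · rw [if_neg hlN, if_neg hlN, hm0 j (by omega), add_zero]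
    · ext j
      have := hj (j + N)
      rw [hshift, hm0 _ (by omega), zero_add] at this
      simpa [Finsupp.comapDomain_apply] using this
  · rintro ⟨⟨a, a'⟩, ⟨b, b'⟩⟩ h
    simp only [Finset.mem_product, Finset.HasAntidiagonal.mem_antidiagonal] at h
    have h0 : ∀ j, N ≤ j → a j = 0 ∧ a' j = 0 := fun j hj => by
      have := hm0 j hj
      rw [← h.1, Finsupp.add_apply] at this
      omega
    have key : ∀ c d : ℕ →₀ ℕ, (∀ j, N ≤ j → c j = 0) →
        (join N c d).filter (· < N) = c ∧
          (join N c d).comapDomain (addRightEmbedding N) hinj.injOn = d := by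
      intro c d hc
      refine ⟨?_, ?_⟩
      · ext j
        rw [Finsupp.filter_apply]
        split_ifs with hj
        · rw [join, Finsupp.add_apply, hlt _ _ hj, add_zero]
        · rw [hc j (by omega)]
      · ext j
        rw [Finsupp.comapDomain_apply, join, Finsupp.add_apply]
        simp only [addRightEmbedding_apply]
        rw [hshift, hc _ (by omega), zero_add]
    simp only [Prod.mk.injEq]
    exact ⟨⟨(key a b fun j hj => (h0 j hj).1).1, (key a' b' fun j hj => (h0 j hj).2).1⟩,
      (key a b fun j hj => (h0 j hj).1).2, (key a' b' fun j hj => (h0 j hj).2).2⟩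
  · rintro ⟨x, y⟩ -
    have key : ∀ c : ℕ →₀ ℕ, join N (c.filter (· < N))
        (c.comapDomain (addRightEmbedding N) hinj.injOn) = c := by
      intro c
      ext j
      rw [join, Finsupp.add_apply, Finsupp.filter_apply]
      by_cases hj : j < N
      · rw [if_pos hj, hlt _ _ hj, add_zero]
      · obtain ⟨k, rfl⟩ := Nat.exists_eq_add_of_le' (not_lt.mp hj)
        rw [if_neg hj, hshift, zero_add]
        rfl
    simp only [key]
  · rintro ⟨⟨a, a'⟩, ⟨b, b'⟩⟩ -
    rfl

namespace TypeData

variable {I : Type} [AddMonoid I]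

theorem cf_eq (D : TypeData S I) (f : invSeries S) {m m' : ℕ →₀ ℕ} (h : D.typ m = D.typ m') : cf m f = cf m' f := by
  obtain ⟨φ, hφ, ψ, hψ, p, rfl, rfl⟩ := D.exists_common m m' h
  exact (f.2.2 φ hφ p).trans (f.2.2 ψ hψ p).symm

theorem wt_eq_zero (D : TypeData S I) {i : I} (h : D.wt i = 0) : i = D.typ 0 := by
  rw [← D.typ_rep i, D.wt_typ] at h
  rw [← (Finsupp.degree_eq_zero_iff (D.rep i)).mp h, D.typ_rep]

theorem typ_zero (D : TypeData S I) : D.typ 0 = 0 := (D.wt_eq_zero (map_zero D.wt)).symm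

theorem typ_eq_zero (D : TypeData S I) {m : ℕ →₀ ℕ} : D.typ m = 0 ↔ m = 0 := by
  refine ⟨fun h => ?_, fun h => h ▸ D.typ_zero⟩
  have := D.wt_typ m
  rw [h, map_zero] at this
  exact (Finsupp.degree_eq_zero_iff m).mp this.symm

open Classical in
/-- The monomial function: the sum of all monomials whose exponent has type `i`. -/
def mono (D : TypeData S I) (i : I) : invSeries S :=
  ⟨fun m => if D.typ m = i then 1 else 0, ⟨D.wt i, fun m hm => if_neg (by
      rintro rfl
      rw [D.wt_typ] at hm
      exact lt_irrefl _ hm)⟩, fun φ hφ m => by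
    change (if D.typ (m.embDomain φ) = i then (1 : ℂ) else 0) = if D.typ m = i then 1 else 0
    rw [D.typ_embDomain φ hφ]⟩

open Classical in
theorem cf_mono (D : TypeData S I) (m : ℕ →₀ ℕ) (i : I) : cf m (D.mono i) = if D.typ m = i then 1 else 0 := rfl

theorem mono_zero (D : TypeData S I) : D.mono 0 = 1 := invSeries_ext fun m => by
  classical
  rw [cf_mono, cf_one]
  simp only [D.typ_eq_zero]

theorem mono_linearIndependent (D : TypeData S I) : LinearIndependent ℂ D.mono := by
  classical
  rw [linearIndependent_iff']
  intro s g h i hi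
  have := congrArg (cf (D.rep i)) h
  rw [map_sum, map_zero] at this
  simpa [cf_mono, D.typ_rep, hi] using this

theorem mono_span (D : TypeData S I) : ⊤ ≤ Submodule.span ℂ (Set.range D.mono) := by
  classical
  rintro f -
  obtain ⟨d, hd⟩ := f.2.1
  have : f = ∑ i ∈ (D.finite_wt_le d).toFinset, cf (D.rep i) f • D.mono i := by
    refine invSeries_ext fun m => ?_
    rw [map_sum]
    simp only [map_smul, cf_mono, smul_eq_mul, mul_ite, mul_one, mul_zero, Finset.sum_ite_eq]
    split_ifs with h
    · exact D.cf_eq f (D.typ_rep _).symm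
    · refine hd m ?_
      simpa [D.wt_typ] using h
  rw [this]
  exact Submodule.sum_mem _ fun i _ => Submodule.smul_mem _ _ (Submodule.subset_span ⟨i, rfl⟩)

/-- The basis of monomial functions. -/
def basis (D : TypeData S I) : Module.Basis I ℂ (invSeries S) :=
  Module.Basis.mk D.mono_linearIndependent D.mono_span

theorem basis_apply (D : TypeData S I) (i : I) : D.basis i = D.mono i := by simp [basis]

theorem basis_repr (D : TypeData S I) (f : invSeries S) (i : I) : D.basis.repr f i = cf (D.rep i) f := by
  classical
  have : D.basis.coord i = cf (D.rep i) := D.basis.ext fun j => by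
    rw [D.basis_apply, cf_mono, D.typ_rep, ← D.basis_apply, Module.Basis.coord_apply,
      Module.Basis.repr_self, Finsupp.single_apply]
    simp only [eq_comm]
  exact congrArg (fun g => g f) this

theorem finite_cuts (D : TypeData S I) (i : I) : {p : I × I | p.1 + p.2 = i}.Finite := by
  refine ((D.finite_wt_le (D.wt i)).prod (D.finite_wt_le (D.wt i))).subset ?_
  rintro ⟨a, b⟩ rfl
  simp

/-- The finite set of pairs `(j, k)` with `j + k = i`. -/
def cuts (D : TypeData S I) (i : I) : Finset (I × I) := (D.finite_cuts i).toFinset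

@[simp] theorem mem_cuts (D : TypeData S I) {i : I} {p : I × I} : p ∈ D.cuts i ↔ p.1 + p.2 = i := by simp [cuts]

/-- The coproduct, given on monomial functions by `Δ M_i = ∑_{j + k = i} M_j ⊗ M_k`. -/
def comulLin (D : TypeData S I) : invSeries S →ₗ[ℂ] invSeries S ⊗[ℂ] invSeries S :=
  D.basis.constr ℂ fun i => ∑ p ∈ D.cuts i, D.mono p.1 ⊗ₜ[ℂ] D.mono p.2

theorem comulLin_mono (D : TypeData S I) (i : I) :
    D.comulLin (D.mono i) = ∑ p ∈ D.cuts i, D.mono p.1 ⊗ₜ[ℂ] D.mono p.2 := by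
  rw [← D.basis_apply, comulLin, Module.Basis.constr_basis]

/-- The linear form `f ⊗ g ↦ cf m f * cf m' g`. -/
def _root_.PeakAlgebra.cf₂ (m m' : ℕ →₀ ℕ) : invSeries S ⊗[ℂ] invSeries S →ₗ[ℂ] ℂ :=
  LinearMap.mul' ℂ ℂ ∘ₗ TensorProduct.map (cf m) (cf m')

@[simp] theorem _root_.PeakAlgebra.cf₂_tmul (m m' : ℕ →₀ ℕ) (f g : invSeries S) :
    cf₂ m m' (f ⊗ₜ[ℂ] g) = cf m f * cf m' g := by simp [cf₂]

theorem tensor_ext (D : TypeData S I) {X Y : invSeries S ⊗[ℂ] invSeries S} (h : ∀ m m', cf₂ m m' X = cf₂ m m' Y) :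
    X = Y := by
  have key : ∀ i j, (D.basis.tensorProduct D.basis).coord (i, j) = cf₂ (D.rep i) (D.rep j) := by
    intro i j
    refine TensorProduct.ext' fun f g => ?_
    simp [basis_repr, mul_comm]
  apply (D.basis.tensorProduct D.basis).repr.injective
  ext ⟨i, j⟩
  have := h (D.rep i) (D.rep j)
  rw [← key] at this
  exact this

theorem cf₂_comulLin (D : TypeData S I) {N : ℕ} {m m' : ℕ →₀ ℕ} (hm : ∀ j ∈ m.support, j < N) (f : invSeries S) :
    cf₂ m m' (D.comulLin f) = cf (join N m m') f := by
  classical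
  have : cf₂ m m' ∘ₗ D.comulLin = cf (join N m m') := D.basis.ext fun i => by
    rw [LinearMap.comp_apply, basis_apply, comulLin_mono, map_sum, cf_mono, D.typ_join N m m' hm]
    simp only [cf₂_tmul, cf_mono, mul_ite, mul_one, mul_zero, ← ite_and]
    split_ifs with h
    · rw [Finset.sum_eq_single (D.typ m, D.typ m')]
      · simp
      · rintro ⟨a, b⟩ - hab
        rw [if_neg]
        rintro ⟨rfl, rfl⟩
        exact hab rfl
      · intro h'
        exact absurd (D.mem_cuts.mpr h) h'
    · refine Finset.sum_eq_zero fun p hp => if_neg ?_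
      rintro ⟨h1, h2⟩
      exact h (by rw [h1, h2]; exact D.mem_cuts.mp hp)
  exact congrArg (fun g => g f) this

theorem _root_.PeakAlgebra.cf₂_mul (m m' : ℕ →₀ ℕ) (X Y : invSeries S ⊗[ℂ] invSeries S) :
    cf₂ m m' (X * Y) = ∑ a ∈ Finset.HasAntidiagonal.antidiagonal m,
      ∑ b ∈ Finset.HasAntidiagonal.antidiagonal m', cf₂ a.1 b.1 X * cf₂ a.2 b.2 Y := by
  induction X using TensorProduct.induction_on with
  | zero => simp
  | add X X' hX hX' =>
    simp only [add_mul, map_add, hX, hX', Finset.sum_add_distrib]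
  | tmul f g =>
    induction Y using TensorProduct.induction_on with
    | zero => simp
    | add Y Y' hY hY' =>
      simp only [mul_add, map_add, hY, hY', Finset.sum_add_distrib]
    | tmul f' g' =>
      rw [Algebra.TensorProduct.tmul_mul_tmul, cf₂_tmul, cf_mul, cf_mul, Finset.sum_mul_sum]
      refine Finset.sum_congr rfl fun a _ => Finset.sum_congr rfl fun b _ => ?_
      rw [cf₂_tmul, cf₂_tmul]
      ring

theorem exists_bound (m : ℕ →₀ ℕ) : ∃ N, ∀ j ∈ m.support, j < N :=
  ⟨m.support.sup id + 1, fun _ hj => Nat.lt_succ_of_le (Finset.le_sup (f := id) hj)⟩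

/-- The coproduct as a homomorphism of algebras. -/
def comulHom (D : TypeData S I) : invSeries S →ₐ[ℂ] invSeries S ⊗[ℂ] invSeries S :=
  AlgHom.ofLinearMap D.comulLin
    (by
      have h0 : D.cuts 0 = {(0, 0)} := by
        ext ⟨a, b⟩
        simp only [mem_cuts, Finset.mem_singleton, Prod.mk.injEq]
        refine ⟨fun h => ?_, fun h => by rw [h.1, h.2, add_zero]⟩
        have := congrArg D.wt h
        rw [map_add, map_zero] at this
        rw [← D.typ_zero]
        exact ⟨D.wt_eq_zero (by omega), D.wt_eq_zero (by omega)⟩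
      rw [← D.mono_zero, comulLin_mono, h0, Finset.sum_singleton, D.mono_zero]
      rfl)
    (fun f g => D.tensor_ext fun m m' => by
      obtain ⟨N, hN⟩ := exists_bound m
      rw [D.cf₂_comulLin hN, cf_mul, sum_antidiagonal_join N m m' hN (fun x y => cf x f * cf y g),
        cf₂_mul]
      refine Finset.sum_congr rfl fun a ha => Finset.sum_congr rfl fun b _ => ?_
      have ha' := Finset.HasAntidiagonal.mem_antidiagonal.mp ha
      have h1 : ∀ j ∈ a.1.support, j < N := fun j hj => hN j (by
        rw [← ha', Finsupp.mem_support_iff, Finsupp.add_apply]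
        rw [Finsupp.mem_support_iff] at hj
        omega)
      have h2 : ∀ j ∈ a.2.support, j < N := fun j hj => hN j (by
        rw [← ha', Finsupp.mem_support_iff, Finsupp.add_apply]
        rw [Finsupp.mem_support_iff] at hj
        omega)
      rw [D.cf₂_comulLin h1, D.cf₂_comulLin h2])

/-- The counit `f ↦ f(0, 0, …)`. -/
def _root_.PeakAlgebra.counitHom : invSeries S →ₐ[ℂ] ℂ :=
  AlgHom.ofLinearMap (cf 0) (by simp [cf_one]) (fun f g => by simp [cf_mul])

/-- The bialgebra structure. -/
abbrev bialgebra (D : TypeData S I) : Bialgebra ℂ (invSeries S) :=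
  Bialgebra.ofAlgHom D.comulHom counitHom
    (by
      apply AlgHom.toLinearMap_injective
      refine D.basis.ext fun i => ?_
      rw [D.basis_apply]
      change TensorProduct.assoc ℂ _ _ _ (TensorProduct.map D.comulLin LinearMap.id
        (D.comulLin (D.mono i))) = TensorProduct.map LinearMap.id D.comulLin (D.comulLin (D.mono i))
      simp only [comulLin_mono, map_sum, TensorProduct.map_tmul, LinearMap.id_apply,
        TensorProduct.sum_tmul, TensorProduct.tmul_sum, TensorProduct.assoc_tmul]
      rw [Finset.sum_sigma', Finset.sum_sigma']
      refine Finset.sum_nbij' (fun x => ⟨(x.2.1, x.2.2 + x.1.2), (x.2.2, x.1.2)⟩)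
        (fun x => ⟨(x.1.1 + x.2.1, x.2.2), (x.1.1, x.2.1)⟩) ?_ ?_ ?_ ?_ ?_
      · rintro ⟨⟨a, b⟩, ⟨c, d⟩⟩ h
        simp only [Finset.mem_sigma, mem_cuts] at h ⊢
        rw [← h.1, ← h.2, add_assoc]
        exact ⟨rfl, trivial⟩
      · rintro ⟨⟨a, b⟩, ⟨c, d⟩⟩ h
        simp only [Finset.mem_sigma, mem_cuts] at h ⊢
        rw [← h.1, ← h.2, add_assoc]
        exact ⟨rfl, trivial⟩
      · rintro ⟨⟨a, b⟩, ⟨c, d⟩⟩ h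
        simp only [Finset.mem_sigma, mem_cuts] at h
        simp [h.2]
      · rintro ⟨⟨a, b⟩, ⟨c, d⟩⟩ h
        simp only [Finset.mem_sigma, mem_cuts] at h
        simp [h.2]
      · rintro ⟨⟨a, b⟩, ⟨c, d⟩⟩ _
        rfl)
    (by
      classical
      apply AlgHom.toLinearMap_injective
      refine D.basis.ext fun i => ?_
      rw [D.basis_apply]
      change TensorProduct.map (cf 0) LinearMap.id (D.comulLin (D.mono i)) = 1 ⊗ₜ[ℂ] D.mono i
      rw [comulLin_mono, map_sum, Finset.sum_eq_single (0, i)]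
      · simp [cf_mono, D.typ_zero]
      · rintro ⟨a, b⟩ h hne
        rw [TensorProduct.map_tmul, cf_mono, D.typ_zero, if_neg, TensorProduct.zero_tmul]
        rintro rfl
        rw [mem_cuts, zero_add] at h
        exact hne (by rw [← h])
      · intro h
        exact absurd (D.mem_cuts.mpr (zero_add i)) h)
    (by
      classical
      apply AlgHom.toLinearMap_injective
      refine D.basis.ext fun i => ?_
      rw [D.basis_apply]
      change TensorProduct.map LinearMap.id (cf 0) (D.comulLin (D.mono i)) = D.mono i ⊗ₜ[ℂ] 1
      rw [comulLin_mono, map_sum, Finset.sum_eq_single (i, 0)]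
      · simp [cf_mono, D.typ_zero]
      · rintro ⟨a, b⟩ h hne
        rw [TensorProduct.map_tmul, cf_mono, D.typ_zero, if_neg, TensorProduct.tmul_zero]
        rintro rfl
        rw [mem_cuts, add_zero] at h
        exact hne (by rw [← h])
      · intro h
        exact absurd (D.mem_cuts.mpr (add_zero i)) h)

end TypeData

section Antipode

variable {A I : Type} [Ring A] [Bialgebra ℂ A] (e : Module.Basis I ℂ A) (wt : I → ℕ)
  (cuts : I → Finset (I × I))

open WithConv

/-- The element `η ε - id` of the convolution ring. -/
def augProj (A : Type) [Ring A] [Bialgebra ℂ A] : WithConv (A →ₗ[ℂ] A) := 1 - toConv LinearMap.id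

/-- Takeuchi's formula `S = ∑ₖ (η ε - id)^{*k}` for the antipode, evaluated on a basis. -/
def takeuchi : A →ₗ[ℂ] A :=
  e.constr ℂ fun i => (∑ k ∈ Finset.range (wt i + 1), augProj A ^ k).ofConv (e i)

variable {e wt cuts}

theorem conv_apply_basis
    (hΔ : ∀ i, Coalgebra.comul (R := ℂ) (e i) = ∑ p ∈ cuts i, e p.1 ⊗ₜ[ℂ] e p.2)
    (f g : WithConv (A →ₗ[ℂ] A)) (i : I) :
    (f * g).ofConv (e i) = ∑ p ∈ cuts i, f.ofConv (e p.1) * g.ofConv (e p.2) := by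
  rw [LinearMap.convMul_apply, hΔ, map_sum, map_sum]
  simp

theorem augProj_pow_apply
    (hΔ : ∀ i, Coalgebra.comul (R := ℂ) (e i) = ∑ p ∈ cuts i, e p.1 ⊗ₜ[ℂ] e p.2)
    (hwt : ∀ i, ∀ p ∈ cuts i, wt p.1 + wt p.2 = wt i) (hone : ∀ i, wt i = 0 → e i = 1) (k : ℕ) :
    ∀ i, wt i < k → (augProj A ^ k).ofConv (e i) = 0 := by
  induction k with
  | zero => intro i hi; omega
  | succ k ih =>
    intro i hi
    rw [pow_succ', conv_apply_basis hΔ]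
    refine Finset.sum_eq_zero fun p hp => ?_
    have hp' := hwt i p hp
    by_cases h : wt p.1 = 0
    · have : (augProj A).ofConv (e p.1) = 0 := by
        rw [hone _ h]
        change algebraMap ℂ A (Coalgebra.counit (1 : A)) - 1 = 0
        simp
      rw [this, zero_mul]
    · rw [ih p.2 (by omega), mul_zero]

theorem takeuchi_apply
    (hΔ : ∀ i, Coalgebra.comul (R := ℂ) (e i) = ∑ p ∈ cuts i, e p.1 ⊗ₜ[ℂ] e p.2)
    (hwt : ∀ i, ∀ p ∈ cuts i, wt p.1 + wt p.2 = wt i) (hone : ∀ i, wt i = 0 → e i = 1) (n : ℕ)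
    (i : I) (hi : wt i ≤ n) :
    takeuchi e wt (e i) = (∑ k ∈ Finset.range (n + 1), augProj A ^ k).ofConv (e i) := by
  rw [takeuchi, Module.Basis.constr_basis]
  have hsum : ∀ s : Finset ℕ, (∑ k ∈ s, augProj A ^ k).ofConv (e i) =
      ∑ k ∈ s, (augProj A ^ k).ofConv (e i) := by
    intro s
    classical
    induction s using Finset.induction_on with
    | empty => rfl
    | insert a s ha ih =>
      rw [Finset.sum_insert ha, Finset.sum_insert ha, ← ih]
      rfl
  rw [hsum, hsum]
  refine Finset.sum_subset (Finset.range_mono (by omega)) fun k _ hk => ?_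
  exact augProj_pow_apply hΔ hwt hone k i (by simpa using hk)

/-- A connected graded bialgebra is a Hopf algebra. -/
abbrev hopfOfBasis
    (hΔ : ∀ i, Coalgebra.comul (R := ℂ) (e i) = ∑ p ∈ cuts i, e p.1 ⊗ₜ[ℂ] e p.2)
    (hwt : ∀ i, ∀ p ∈ cuts i, wt p.1 + wt p.2 = wt i) (hone : ∀ i, wt i = 0 → e i = 1) :
    HopfAlgebra ℂ A :=
  { ‹Bialgebra ℂ A› with
    antipode := takeuchi e wt
    mul_antipode_rTensor_comul := by
      refine e.ext fun i => ?_
      change (toConv (takeuchi e wt) * toConv LinearMap.id).ofConv (e i) =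
        (1 : WithConv (A →ₗ[ℂ] A)).ofConv (e i)
      have h1 : toConv LinearMap.id = 1 - augProj A := by rw [augProj, sub_sub_cancel]
      have h2 : (∑ k ∈ Finset.range (wt i + 1), augProj A ^ k) * toConv LinearMap.id =
          1 - augProj A ^ (wt i + 1) := by
        rw [h1, geom_sum_mul_neg]
      have h3 := congrArg (fun f => f.ofConv (e i)) h2
      have h4 : (1 - augProj A ^ (wt i + 1)).ofConv (e i) =
          (1 : WithConv (A →ₗ[ℂ] A)).ofConv (e i) := by
        change (1 : WithConv (A →ₗ[ℂ] A)).ofConv (e i) - (augProj A ^ (wt i + 1)).ofConv (e i) = _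
        rw [augProj_pow_apply hΔ hwt hone _ i (Nat.lt_succ_self _), sub_zero]
      rw [h4] at h3
      rw [← h3, conv_apply_basis hΔ, conv_apply_basis hΔ]
      refine Finset.sum_congr rfl fun p hp => ?_
      have := hwt i p hp
      rw [← takeuchi_apply hΔ hwt hone (wt i) p.1 (by omega)]
    mul_antipode_lTensor_comul := by
      refine e.ext fun i => ?_
      change (toConv LinearMap.id * toConv (takeuchi e wt)).ofConv (e i) =
        (1 : WithConv (A →ₗ[ℂ] A)).ofConv (e i)
      have h1 : toConv LinearMap.id = 1 - augProj A := by rw [augProj, sub_sub_cancel]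
      have h2 : toConv LinearMap.id * (∑ k ∈ Finset.range (wt i + 1), augProj A ^ k) =
          1 - augProj A ^ (wt i + 1) := by
        rw [h1, mul_neg_geom_sum]
      have h3 := congrArg (fun f => f.ofConv (e i)) h2
      have h4 : (1 - augProj A ^ (wt i + 1)).ofConv (e i) =
          (1 : WithConv (A →ₗ[ℂ] A)).ofConv (e i) := by
        change (1 : WithConv (A →ₗ[ℂ] A)).ofConv (e i) - (augProj A ^ (wt i + 1)).ofConv (e i) = _
        rw [augProj_pow_apply hΔ hwt hone _ i (Nat.lt_succ_self _), sub_zero]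
      rw [h4] at h3
      rw [← h3, conv_apply_basis hΔ, conv_apply_basis hΔ]
      refine Finset.sum_congr rfl fun p hp => ?_
      have := hwt i p hp
      rw [← takeuchi_apply hΔ hwt hone (wt i) p.2 (by omega)] }

end Antipode

/-- The Hopf algebra structure. -/
abbrev TypeData.hopfAlgebra {I : Type} [AddMonoid I] (D : TypeData S I) :
    HopfAlgebra ℂ (invSeries S) :=
  letI := D.bialgebra
  hopfOfBasis (e := D.basis) (wt := D.wt) (cuts := D.cuts)
    (fun i => by
      rw [D.basis_apply]
      simp only [D.basis_apply]
      exact D.comulLin_mono i)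
    (fun i p hp => by rw [← map_add, D.mem_cuts.mp hp])
    (fun i hi => by rw [D.basis_apply, D.wt_eq_zero hi, D.typ_zero, D.mono_zero])

/-! ### Quasisymmetric and symmetric functions -/

/-- The list `(a₁, …, aₖ)` of nonzero exponents of the monomial
`x_{i₁}^{a₁} ⋯ x_{iₖ}^{aₖ}`, where `i₁ < ⋯ < iₖ`. -/
def expList (m : ℕ →₀ ℕ) : List ℕ+ := m.support.sort.map fun i => (m i).toPNat'

/-- The exponent of `x₀^{a₁} ⋯ x_{k-1}^{aₖ}`. -/
def pack (l : List ℕ+) : ℕ →₀ ℕ :=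
  Finsupp.onFinset (Finset.range l.length) (fun i => (l[i]?.map PNat.val).getD 0) (by
    intro i hi
    by_contra h
    rw [Finset.mem_range, not_lt] at h
    simp [h] at hi)

theorem pack_apply (l : List ℕ+) (i : ℕ) : pack l i = (l[i]?.map PNat.val).getD 0 := rfl

theorem pack_of_lt (l : List ℕ+) (i : ℕ) (h : i < l.length) : pack l i = l[i] := by
  simp [pack_apply, h]

theorem pack_support (l : List ℕ+) : (pack l).support = Finset.range l.length := by
  ext i
  rw [Finsupp.mem_support_iff, Finset.mem_range]
  by_cases h : i < l.length
  · simp [pack_of_lt l i h, h]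
  · simp [pack_apply, h]

theorem expList_pack (l : List ℕ+) : expList (pack l) = l := by
  rw [expList, pack_support, Finset.sort_range]
  apply List.ext_getElem
  · simp
  · intro i h1 h2
    simp [pack_of_lt l i h2]

theorem expList_embDomain {φ : ℕ ↪ ℕ} (hφ : StrictMono φ) (m : ℕ →₀ ℕ) :
    expList (m.embDomain φ) = expList m := by
  rw [expList, expList, Finsupp.support_embDomain,
    ← Finset.map_sort φ m.support _ _ (fun a _ b _ => hφ.le_iff_le.symm), List.map_map]
  refine List.map_congr_left fun i _ => ?_
  simp [Finsupp.embDomain_apply_self]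

theorem coe_expList (m : ℕ →₀ ℕ) :
    (expList m : Multiset ℕ+) = m.support.val.map fun i => (m i).toPNat' := by
  rw [expList, ← Multiset.map_coe, Finset.sort_eq]

theorem coe_expList_embDomain (φ : ℕ ↪ ℕ) (m : ℕ →₀ ℕ) :
    (expList (m.embDomain φ) : Multiset ℕ+) = expList m := by
  rw [coe_expList, coe_expList, Finsupp.support_embDomain, Finset.map_val, Multiset.map_map]
  refine Multiset.map_congr rfl fun i _ => ?_
  simp [Finsupp.embDomain_apply_self]

theorem sum_expList (m : ℕ →₀ ℕ) : ((expList m).map PNat.val).sum = m.degree := by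
  have h : ((expList m : Multiset ℕ+).map PNat.val).sum = m.degree := by
    rw [coe_expList, Multiset.map_map, Finsupp.degree_apply]
    change ∑ i ∈ m.support, _ = _
    refine Finset.sum_congr rfl fun i hi => ?_
    have : 0 < m i := Nat.pos_of_ne_zero (Finsupp.mem_support_iff.mp hi)
    simp [Nat.toPNat'_coe, this]
  simpa using h

theorem expList_join (N : ℕ) (m m' : ℕ →₀ ℕ) (hm : ∀ j ∈ m.support, j < N) :
    expList (join N m m') = expList m ++ expList m' := by
  have hmono : StrictMono (addRightEmbedding N : ℕ ↪ ℕ) := fun a b h => by simpa using h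
  have hlt : ∀ j, j < N → m'.embDomain (addRightEmbedding N) j = 0 := by
    intro j hj
    apply Finsupp.embDomain_of_notMem_range
    rintro ⟨k, hk⟩
    simp at hk
    omega
  have hmem' : ∀ j ∈ (m'.embDomain (addRightEmbedding N)).support, N ≤ j := by
    intro j hj
    by_contra h
    exact (Finsupp.mem_support_iff.mp hj) (hlt j (by omega))
  rw [← expList_embDomain hmono m']
  set m'' := m'.embDomain (addRightEmbedding N) with hm''
  have hdisj : Disjoint m.support m''.support := by
    rw [Finset.disjoint_left]
    intro j h1 h2
    exact absurd (hm j h1) (not_lt.mpr (hmem' j h2))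
  have hsupp : (join N m m').support = m.support ∪ m''.support :=
    Finsupp.support_add_eq hdisj
  have hsort : (join N m m').support.sort = m.support.sort ++ m''.support.sort := by
    refine List.Perm.eq_of_pairwise' (r := (· ≤ ·)) (Finset.pairwise_sort _ _) ?_ ?_
    · rw [List.pairwise_append]
      refine ⟨Finset.pairwise_sort _ _, Finset.pairwise_sort _ _, fun a ha b hb => ?_⟩
      rw [Finset.mem_sort] at ha hb
      exact (hm a ha).le.trans (hmem' b hb)
    · rw [← Multiset.coe_eq_coe, ← Multiset.coe_add, Finset.sort_eq, Finset.sort_eq,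
        Finset.sort_eq, hsupp, ← Finset.disjUnion_eq_union _ _ hdisj]
      rfl
  rw [expList, hsort, List.map_append, expList, expList]
  congr 1
  · refine List.map_congr_left fun i hi => ?_
    rw [Finset.mem_sort] at hi
    rw [join, Finsupp.add_apply, hlt i (hm i hi), add_zero]
  · refine List.map_congr_left fun i hi => ?_
    rw [Finset.mem_sort] at hi
    have : m i = 0 := by
      by_contra h
      exact absurd (hm i (Finsupp.mem_support_iff.mpr h)) (not_lt.mpr (hmem' i hi))
    rw [join, Finsupp.add_apply, this, zero_add]

theorem exists_embDomain_pack (m : ℕ →₀ ℕ) :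
    ∃ φ : ℕ ↪ ℕ, StrictMono φ ∧ m = (pack (expList m)).embDomain φ := by
  set s := m.support.sort with hs
  have hsm : s.SortedLT := Finset.sortedLT_sort m.support
  have hlen : (expList m).length = s.length := by simp [expList, hs]
  let f : ℕ → ℕ := fun i => if h : i < s.length then s[i] else m.support.sup id + 1 + i
  have hf : StrictMono f := by
    intro i j hij
    simp only [f]
    split_ifs with h1 h2 h2
    · exact hsm.getElem_lt_getElem_of_lt hij
    · have : s[i] ∈ m.support := by
        rw [← Finset.mem_sort (· ≤ ·)]
        exact List.getElem_mem h1
      have := Finset.le_sup (f := id) this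
      simp only [id] at this
      omega
    · omega
    · omega
  refine ⟨⟨f, hf.injective⟩, hf, ?_⟩
  ext n
  by_cases hn : n ∈ m.support
  · have hn' : n ∈ s := (Finset.mem_sort _).mpr hn
    obtain ⟨i, hi, rfl⟩ := List.mem_iff_getElem.mp hn'
    have hfi : (⟨f, hf.injective⟩ : ℕ ↪ ℕ) i = s[i] := by
      change f i = _
      simp only [f, dif_pos hi]
    have hpos : 0 < m s[i] := Nat.pos_of_ne_zero (Finsupp.mem_support_iff.mp hn)
    rw [← hfi, Finsupp.embDomain_apply_self, hfi, pack_of_lt _ _ (by omega)]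
    simp [expList, ← hs, Nat.toPNat'_coe, hpos]
  · rw [Finsupp.notMem_support_iff.mp hn]
    symm
    by_cases hr : n ∈ Set.range (⟨f, hf.injective⟩ : ℕ ↪ ℕ)
    · obtain ⟨i, rfl⟩ := hr
      rw [Finsupp.embDomain_apply_self, ← Finsupp.notMem_support_iff, pack_support,
        Finset.mem_range, hlen]
      intro hi
      apply hn
      rw [← Finset.mem_sort (· ≤ ·)]
      change f i ∈ s
      simp only [f, dif_pos hi]
      exact List.getElem_mem hi
    · exact Finsupp.embDomain_of_notMem_range _ _ _ hr

theorem exists_perm_pack {l l' : List ℕ+} (h : l.Perm l') :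
    ∃ σ : Equiv.Perm ℕ, ∀ i, pack l' i = pack l (σ i) := by
  induction h with
  | nil => exact ⟨1, fun i => rfl⟩
  | cons a _ ih =>
    obtain ⟨σ, hσ⟩ := ih
    refine ⟨⟨fun | 0 => 0 | i + 1 => σ i + 1, fun | 0 => 0 | i + 1 => σ.symm i + 1, ?_, ?_⟩, ?_⟩
    · rintro (_ | i) <;> simp
    · rintro (_ | i) <;> simp
    · rintro (_ | i)
      · rfl
      · exact hσ i
  | swap a b l =>
    refine ⟨Equiv.swap 0 1, ?_⟩
    rintro (_ | _ | i)
    · simp [pack_apply]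
    · simp [pack_apply]
    · rw [Equiv.swap_apply_of_ne_of_ne (by omega) (by omega)]
      rfl
  | trans _ _ ih1 ih2 =>
    obtain ⟨σ, hσ⟩ := ih1
    obtain ⟨τ, hτ⟩ := ih2
    exact ⟨τ.trans σ, fun i => by rw [hτ, hσ]; rfl⟩

theorem finite_lists (d : ℕ) : {l : List ℕ+ | (l.map PNat.val).sum ≤ d}.Finite := by
  refine ((List.finite_length_le (Fin d) d).image (List.map fun i : Fin d => i.val.succPNat)).subset ?_
  intro l hl
  have hl' : (l.map PNat.val).sum ≤ d := hl
  have hmem : ∀ x ∈ l, (x : ℕ) ≤ d := fun x hx =>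
    (List.single_le_sum (by simp) _ (List.mem_map_of_mem hx)).trans hl'
  have hlen : l.length ≤ d := by
    refine le_trans ?_ hl'
    have := List.length_le_sum_of_one_le (l.map PNat.val) (by
      intro i hi
      obtain ⟨x, -, rfl⟩ := List.mem_map.mp hi
      exact x.pos)
    simpa using this
  have : l ∈ Set.range (List.map fun i : Fin d => i.val.succPNat) := by
    rw [Set.range_list_map]
    intro x hx
    refine ⟨⟨x.natPred, ?_⟩, ?_⟩
    · have h1 := hmem x hx
      have h2 := x.natPred_add_one
      omega
    · apply PNat.natPred_injective
      rfl
  obtain ⟨l', rfl⟩ := this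
  exact ⟨l', by simpa using hlen, rfl⟩

/-- The strictly increasing reindexings of the variables. -/
def increasingReindexings : Set (ℕ ↪ ℕ) := {φ | StrictMono φ}

/-- The algebra of quasisymmetric functions: power series of bounded degree such that the
coefficients of `x_{i₁}^{a₁} ⋯ x_{iₖ}^{aₖ}` and `x_{j₁}^{a₁} ⋯ x_{jₖ}^{aₖ}` agree whenever
`i₁ < ⋯ < iₖ` and `j₁ < ⋯ < jₖ`. -/
abbrev QSym : Type := invSeries increasingReindexings

/-- The algebra of symmetric functions: power series of bounded degree which are invariant under
all reindexings of the variables. -/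
abbrev SymFun : Type := invSeries (Set.univ : Set (ℕ ↪ ℕ))

/-- Types of exponents for quasisymmetric functions: compositions, with concatenation. The monomial
functions `qsymData.mono α` are the monomial quasisymmetric functions `M_α`. -/
def qsymData : TypeData increasingReindexings (FreeAddMonoid ℕ+) where
  typ m := FreeAddMonoid.ofList (expList m)
  rep α := pack α.toList
  wt := FreeAddMonoid.lift PNat.val
  typ_rep α := congrArg FreeAddMonoid.ofList (expList_pack α.toList)
  typ_embDomain φ hφ m := congrArg FreeAddMonoid.ofList (expList_embDomain hφ m)
  exists_common m m' h := by
    obtain ⟨φ, hφ, h1⟩ := exists_embDomain_pack m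
    obtain ⟨ψ, hψ, h2⟩ := exists_embDomain_pack m'
    refine ⟨φ, hφ, ψ, hψ, pack (expList m), h1, ?_⟩
    rw [show expList m = expList m' from h]
    exact h2
  typ_join N m m' hm := congrArg FreeAddMonoid.ofList (expList_join N m m' hm)
  wt_typ m := by
    rw [FreeAddMonoid.lift_apply]
    exact sum_expList m
  finite_wt_le d := by
    refine (finite_lists d).subset fun (α : FreeAddMonoid ℕ+) hα => ?_
    have h : FreeAddMonoid.lift PNat.val α ≤ d := hα
    rw [FreeAddMonoid.lift_apply] at h
    exact h

/-- Types of exponents for symmetric functions: partitions, as multisets, with union. The monomial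
functions `symData.mono μ` are the monomial symmetric functions `m_μ`. -/
def symData : TypeData (Set.univ : Set (ℕ ↪ ℕ)) (Multiset ℕ+) where
  typ m := (expList m : Multiset ℕ+)
  rep μ := pack μ.toList
  wt := Multiset.sumAddMonoidHom.comp (Multiset.mapAddMonoidHom PNat.val)
  typ_rep μ := by rw [expList_pack, Multiset.coe_toList]
  typ_embDomain φ _ m := coe_expList_embDomain φ m
  exists_common m m' h := by
    obtain ⟨φ, -, h1⟩ := exists_embDomain_pack m
    obtain ⟨ψ, -, h2⟩ := exists_embDomain_pack m'
    obtain ⟨σ, hσ⟩ := exists_perm_pack (Multiset.coe_eq_coe.mp h)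
    refine ⟨φ, trivial, σ.symm.toEmbedding.trans ψ, trivial, pack (expList m), h1, ?_⟩
    have h3 : pack (expList m') = (pack (expList m)).embDomain σ.symm.toEmbedding := by
      ext i
      rw [hσ, ← Finsupp.embDomain_apply_self σ.symm.toEmbedding (pack (expList m)) (σ i)]
      simp
    conv_lhs => rw [h2, h3]
    simp only [Finsupp.embDomain_eq_mapDomain]
    rw [← Finsupp.mapDomain_comp]
    rfl
  typ_join N m m' hm := by
    rw [expList_join N m m' hm, Multiset.coe_add]
  wt_typ m := by
    rw [← sum_expList m]
    simp
  finite_wt_le d := by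
    refine ((finite_lists d).image (fun l : List ℕ+ => (l : Multiset ℕ+))).subset fun μ hμ => ?_
    refine ⟨μ.toList, ?_, μ.coe_toList⟩
    rw [← μ.coe_toList] at hμ
    simpa using hμ

instance qsymHopf : HopfAlgebra ℂ QSym := qsymData.hopfAlgebra

instance symHopf : HopfAlgebra ℂ SymFun := symData.hopfAlgebra

/-- The coproduct of `QSym` is deconcatenation of compositions in the monomial basis. -/
theorem comul_qsym_mono (α : FreeAddMonoid ℕ+) :
    Coalgebra.comul (R := ℂ) (qsymData.mono α) =
      ∑ p ∈ qsymData.cuts α, qsymData.mono p.1 ⊗ₜ[ℂ] qsymData.mono p.2 :=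
  qsymData.comulLin_mono α

/-- The inclusion of `Sym` in `QSym`, a morphism of bialgebras. -/
def symToQSym : SymFun →ₐc[ℂ] QSym :=
  BialgHom.ofAlgHom
    (Subalgebra.inclusion fun _ hf => ⟨hf.1, fun φ _ => hf.2 φ trivial⟩)
    (AlgHom.ext fun _ => rfl)
    (AlgHom.ext fun f => qsymData.tensor_ext fun m m' => by
      obtain ⟨N, hN⟩ := TypeData.exists_bound m
      refine Eq.trans ?_ (qsymData.cf₂_comulLin hN _).symm
      refine Eq.trans ?_ (symData.cf₂_comulLin hN f)
      have : ∀ X : SymFun ⊗[ℂ] SymFun, cf₂ m m' (Algebra.TensorProduct.map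
          (Subalgebra.inclusion fun _ hf => ⟨hf.1, fun φ _ => hf.2 φ trivial⟩ : SymFun →ₐ[ℂ] QSym)
          (Subalgebra.inclusion fun _ hf => ⟨hf.1, fun φ _ => hf.2 φ trivial⟩ : SymFun →ₐ[ℂ] QSym)
          X) = cf₂ m m' X := by
        intro X
        induction X using TensorProduct.induction_on with
        | zero => simp
        | add X Y hX hY => rw [map_add, map_add, hX, hY, map_add]
        | tmul f g =>
          rw [Algebra.TensorProduct.map_tmul, cf₂_tmul, cf₂_tmul]
          rfl
      exact this _)

open Classical in
/-- The power sum `∑ᵢ xᵢⁿ`, for `n ≥ 1`. -/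
def powerSum (n : ℕ) : SymFun :=
  ⟨fun m => if ∃ i, m = Finsupp.single i n then 1 else 0,
    ⟨n, fun m hm => if_neg (by
      rintro ⟨i, rfl⟩
      simp at hm)⟩, fun φ _ m => by
    have h : (∃ i, m.embDomain φ = Finsupp.single i n) ↔ ∃ i, m = Finsupp.single i n := by
      constructor
      · rintro ⟨i, hi⟩
        rcases eq_or_ne n 0 with rfl | hn
        · exact ⟨0, by simpa using hi⟩
        · obtain ⟨x, hx, -⟩ := Finsupp.single_of_embDomain_single m φ i n hn hi
          exact ⟨x, hx⟩
      · rintro ⟨i, rfl⟩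
        exact ⟨φ i, by rw [Finsupp.embDomain_single]⟩
    change (if ∃ i, m.embDomain φ = Finsupp.single i n then (1 : ℂ) else 0) =
      if ∃ i, m = Finsupp.single i n then 1 else 0
    simp only [h]⟩

/-- The scaled power sum `p_n = (1 / n) ∑ᵢ xᵢⁿ`, for `n ≥ 1`. -/
def scaledPowerSum (n : ℕ) : SymFun := (1 / n : ℂ) • powerSum n

open WithConv

/-- The character `ζ_QSym(f) = f(1, 0, 0, …)`. -/
def zetaQSym : QSym →ₐ[ℂ] ℂ := (Polynomial.aeval (1 : ℂ)).comp toPoly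

/-- The restriction `ζ_Sym` of `ζ_QSym` to symmetric functions. -/
def zetaSym : SymFun →ₐ[ℂ] ℂ := zetaQSym.comp (symToQSym : SymFun →ₐ[ℂ] QSym)

/-- The character `ζ̄`, which is `(-1) ^ n ζ` in degree `n`. -/
def barChar (ζ : invSeries S →ₐ[ℂ] ℂ) : invSeries S →ₐ[ℂ] ℂ := ζ.comp signHom

/-- The convolution product of `bar (ζ_QSym⁻¹)` and `ζ_QSym`, where `⁻¹` is the inverse in the
group of characters. -/
def oddZetaQSym : QSym →ₐ[ℂ] ℂ :=
  (toConv (barChar ((toConv zetaQSym)⁻¹).ofConv) * toConv zetaQSym).ofConv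

/-- The convolution product of `bar (ζ_Sym⁻¹)` and `ζ_Sym`. -/
def oddZetaSym : SymFun →ₐ[ℂ] ℂ :=
  (toConv (barChar ((toConv zetaSym)⁻¹).ofConv) * toConv zetaSym).ofConv

end Series

/-! ### The Hopf algebra structure on a tensor algebra -/

section TensorHopf

variable {V : Type*} [AddCommGroup V] [Module ℂ V]

/-- The bialgebra structure on the tensor algebra for which the elements of `V` are primitive. -/
instance tensorBialgebra : Bialgebra ℂ (TensorAlgebra ℂ V) :=
  .ofAlgHom
    (TensorAlgebra.lift ℂ <| (TensorProduct.mk ℂ _ _).flip 1 ∘ₗ TensorAlgebra.ι ℂ +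
      TensorProduct.mk ℂ _ _ 1 ∘ₗ TensorAlgebra.ι ℂ)
    TensorAlgebra.algebraMapInv
    (by
      ext x
      simp [Algebra.TensorProduct.one_def, TensorProduct.add_tmul, TensorProduct.tmul_add]
      abel)
    (by ext x; simp [TensorAlgebra.algebraMapInv])
    (by ext x; simp [TensorAlgebra.algebraMapInv])

theorem comul_ι (x : V) : Coalgebra.comul (R := ℂ) (TensorAlgebra.ι ℂ x) =
    TensorAlgebra.ι ℂ x ⊗ₜ[ℂ] 1 + 1 ⊗ₜ[ℂ] TensorAlgebra.ι ℂ x :=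
  TensorAlgebra.lift_ι_apply _ x

theorem counit_ι (x : V) : Coalgebra.counit (R := ℂ) (TensorAlgebra.ι ℂ x) = 0 :=
  (TensorAlgebra.lift_ι_apply _ x).trans rfl

/-- The anti-automorphism of the tensor algebra with `x ↦ -x` for `x ∈ V`. -/
def tensorAntipode : TensorAlgebra ℂ V →ₗ[ℂ] TensorAlgebra ℂ V :=
  (MulOpposite.opLinearEquiv ℂ).symm.toLinearMap ∘ₗ (TensorAlgebra.lift ℂ
    (-((MulOpposite.opLinearEquiv ℂ).toLinearMap ∘ₗ TensorAlgebra.ι ℂ)) :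
      TensorAlgebra ℂ V →ₐ[ℂ] (TensorAlgebra ℂ V)ᵐᵒᵖ).toLinearMap

theorem tensorAntipode_ι (x : V) :
    tensorAntipode (TensorAlgebra.ι ℂ x) = -TensorAlgebra.ι ℂ x := by
  simp [tensorAntipode]

theorem tensorAntipode_one : tensorAntipode (1 : TensorAlgebra ℂ V) = 1 := by
  simp [tensorAntipode]

theorem tensorAntipode_mul (a b : TensorAlgebra ℂ V) :
    tensorAntipode (a * b) = tensorAntipode b * tensorAntipode a := by
  simp [tensorAntipode]

theorem antipode_left_mul (X Y : TensorAlgebra ℂ V ⊗[ℂ] TensorAlgebra ℂ V) (c : ℂ)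
    (hX : LinearMap.mul' ℂ _ (tensorAntipode.rTensor _ X) = algebraMap ℂ (TensorAlgebra ℂ V) c) :
    LinearMap.mul' ℂ _ (tensorAntipode.rTensor _ (X * Y)) =
      c • LinearMap.mul' ℂ _ (tensorAntipode.rTensor _ Y) := by
  induction Y using TensorProduct.induction_on with
  | zero => simp
  | add Y Y' h h' => simp only [mul_add, map_add, h, h', smul_add]
  | tmul y z =>
    have : ∀ X : TensorAlgebra ℂ V ⊗[ℂ] TensorAlgebra ℂ V,
        LinearMap.mul' ℂ _ (tensorAntipode.rTensor _ (X * y ⊗ₜ[ℂ] z)) =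
          tensorAntipode y * LinearMap.mul' ℂ _ (tensorAntipode.rTensor _ X) * z := by
      intro X
      induction X using TensorProduct.induction_on with
      | zero => simp
      | add X X' h h' => simp only [add_mul, mul_add, map_add, h, h']
      | tmul u v => simp [tensorAntipode_mul, mul_assoc]
    rw [this, hX, ← Algebra.commutes, mul_assoc, ← Algebra.smul_def]
    simp

theorem antipode_right_mul (X Y : TensorAlgebra ℂ V ⊗[ℂ] TensorAlgebra ℂ V) (c : ℂ)
    (hY : LinearMap.mul' ℂ _ (tensorAntipode.lTensor _ Y) = algebraMap ℂ (TensorAlgebra ℂ V) c) :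
    LinearMap.mul' ℂ _ (tensorAntipode.lTensor _ (X * Y)) =
      c • LinearMap.mul' ℂ _ (tensorAntipode.lTensor _ X) := by
  induction X using TensorProduct.induction_on with
  | zero => simp
  | add Y Y' h h' => simp only [add_mul, map_add, h, h', smul_add]
  | tmul y z =>
    have : ∀ Y : TensorAlgebra ℂ V ⊗[ℂ] TensorAlgebra ℂ V,
        LinearMap.mul' ℂ _ (tensorAntipode.lTensor _ (y ⊗ₜ[ℂ] z * Y)) =
          y * LinearMap.mul' ℂ _ (tensorAntipode.lTensor _ Y) * tensorAntipode z := by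
      intro Y
      induction Y using TensorProduct.induction_on with
      | zero => simp
      | add X X' h h' => simp only [add_mul, mul_add, map_add, h, h']
      | tmul u v => simp [tensorAntipode_mul, mul_assoc]
    rw [this, hY, ← Algebra.commutes, mul_assoc, ← Algebra.smul_def]
    simp

instance tensorHopf : HopfAlgebra ℂ (TensorAlgebra ℂ V) where
  antipode := tensorAntipode
  mul_antipode_rTensor_comul := by
    ext a
    change LinearMap.mul' ℂ _ (tensorAntipode.rTensor _ (Coalgebra.comul (R := ℂ) a)) =
      algebraMap ℂ _ (Coalgebra.counit (R := ℂ) a)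
    induction a using TensorAlgebra.induction with
    | algebraMap r =>
      rw [Bialgebra.comul_algebraMap, Bialgebra.counit_algebraMap, Algebra.algebraMap_eq_smul_one,
        map_smul, map_smul, Algebra.TensorProduct.one_def, LinearMap.rTensor_tmul,
        tensorAntipode_one, LinearMap.mul'_apply, mul_one, Algebra.algebraMap_eq_smul_one]
    | ι x => simp [comul_ι, counit_ι, tensorAntipode_ι, tensorAntipode_one]
    | mul a b ha hb =>
      rw [Bialgebra.comul_mul, antipode_left_mul _ _ _ ha, hb, Bialgebra.counit_mul, map_mul,
        Algebra.smul_def]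
    | add a b ha hb => simp only [map_add, ha, hb]
  mul_antipode_lTensor_comul := by
    ext a
    change LinearMap.mul' ℂ _ (tensorAntipode.lTensor _ (Coalgebra.comul (R := ℂ) a)) =
      algebraMap ℂ _ (Coalgebra.counit (R := ℂ) a)
    induction a using TensorAlgebra.induction with
    | algebraMap r =>
      rw [Bialgebra.comul_algebraMap, Bialgebra.counit_algebraMap, Algebra.algebraMap_eq_smul_one,
        map_smul, map_smul, Algebra.TensorProduct.one_def, LinearMap.lTensor_tmul,
        tensorAntipode_one, LinearMap.mul'_apply, mul_one, Algebra.algebraMap_eq_smul_one]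
    | ι x => simp [comul_ι, counit_ι, tensorAntipode_ι, tensorAntipode_one]
    | mul a b ha hb =>
      rw [Bialgebra.comul_mul, antipode_right_mul _ _ _ hb, ha, Bialgebra.counit_mul,
        Algebra.smul_def, ← map_mul, mul_comm]
    | add a b ha hb => simp only [map_add, ha, hb]

end TensorHopf

/-! ### Combinatorial Hopf algebras and theta maps -/

section Theta

variable {H H' : Type*} [Ring H] [HopfAlgebra ℂ H] [Ring H'] [HopfAlgebra ℂ H']

/-- The submodules `𝒜 n` are the homogeneous components of a grading of `H` which makes it a graded
connected Hopf algebra. -/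
structure IsGradedConnectedHopf (𝒜 : ℕ → Submodule ℂ H) : Prop where
  isInternal : DirectSum.IsInternal 𝒜
  one_mem : 1 ∈ 𝒜 0
  mul_mem : ∀ i j, ∀ a ∈ 𝒜 i, ∀ b ∈ 𝒜 j, a * b ∈ 𝒜 (i + j)
  comul_mem : ∀ n, ∀ a ∈ 𝒜 n, Coalgebra.comul (R := ℂ) a ∈
    ⨆ p ∈ Finset.HasAntidiagonal.antidiagonal n,
      LinearMap.range (TensorProduct.map (𝒜 p.1).subtype (𝒜 p.2).subtype)
  counit_eq_zero : ∀ n, n ≠ 0 → ∀ a ∈ 𝒜 n, Coalgebra.counit (R := ℂ) a = 0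
  antipode_mem : ∀ n, ∀ a ∈ 𝒜 n, HopfAlgebra.antipode ℂ a ∈ 𝒜 n
  connected : 𝒜 0 = Submodule.span ℂ {1}

/-- The linear map `f` is a morphism of graded Hopf algebras: it is a morphism of bialgebras, hence
compatible with the antipodes, and preserves degrees. -/
def IsGradedHopfMorphism (𝒜 : ℕ → Submodule ℂ H) (ℬ : ℕ → Submodule ℂ H') (f : H →ₗ[ℂ] H') :
    Prop :=
  (∃ F : H →ₐc[ℂ] H', ∀ x, F x = f x) ∧ ∀ n, ∀ x ∈ 𝒜 n, f x ∈ ℬ n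

/-- The linear map `f` is a morphism `(H, ζ) → (H', ζ')` of combinatorial Hopf algebras. -/
def IsCombHopfMorphism (𝒜 : ℕ → Submodule ℂ H) (ζ : H →ₐ[ℂ] ℂ) (ℬ : ℕ → Submodule ℂ H')
    (ζ' : H' →ₐ[ℂ] ℂ) (f : H →ₗ[ℂ] H') : Prop :=
  IsGradedHopfMorphism 𝒜 ℬ f ∧ ∀ x, ζ' (f x) = ζ x

/-- The linear map `f` is the unique morphism `(H, ζ) → (H', ζ')` of combinatorial Hopf algebras. -/
def IsUniqueCombHopfMorphism (𝒜 : ℕ → Submodule ℂ H) (ζ : H →ₐ[ℂ] ℂ) (ℬ : ℕ → Submodule ℂ H')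
    (ζ' : H' →ₐ[ℂ] ℂ) (f : H →ₗ[ℂ] H') : Prop :=
  IsCombHopfMorphism 𝒜 ζ ℬ ζ' f ∧ ∀ g, IsCombHopfMorphism 𝒜 ζ ℬ ζ' g → g = f

/-- The linear map `f` is `Θ_QSym`, the unique morphism of combinatorial Hopf algebras from `QSym`
with the character `bar (ζ_QSym⁻¹) * ζ_QSym` to `(QSym, ζ_QSym)`. -/
def IsThetaQSym (f : QSym →ₗ[ℂ] QSym) : Prop :=
  IsUniqueCombHopfMorphism (homogeneous _) oddZetaQSym (homogeneous _) zetaQSym f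

/-- The linear map `f` is `Θ_Sym`, the unique morphism of combinatorial Hopf algebras from `Sym`
with the character `bar (ζ_Sym⁻¹) * ζ_Sym` to `(Sym, ζ_Sym)`. -/
def IsThetaSym (f : SymFun →ₗ[ℂ] SymFun) : Prop :=
  IsUniqueCombHopfMorphism (homogeneous _) oddZetaSym (homogeneous _) zetaSym f

/-- `Θ` is a theta map for the combinatorial Hopf algebra `(H, ζ)` with the grading `𝒜`: it
satisfies `Φ ∘ Θ = Θ_QSym ∘ Φ` for the unique morphism `Φ : (H, ζ) → (QSym, ζ_QSym)` of
combinatorial Hopf algebras. The range of `Θ` is then called a peak algebra for `(H, ζ)`. -/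
def IsThetaMap (𝒜 : ℕ → Submodule ℂ H) (ζ : H →ₐ[ℂ] ℂ) (Θ : H →ₗ[ℂ] H) : Prop :=
  IsGradedConnectedHopf 𝒜 ∧
    ∃ (Φ : H →ₗ[ℂ] QSym) (ΘQ : QSym →ₗ[ℂ] QSym),
      IsUniqueCombHopfMorphism 𝒜 ζ (homogeneous _) zetaQSym Φ ∧ IsThetaQSym ΘQ ∧ Φ ∘ₗ Θ = ΘQ ∘ₗ Φ

end Theta

/-! ### The tensor algebra of a graded vector space with a homogeneous basis -/

section TensorTheta

variable {I V : Type*} [AddCommGroup V] [Module ℂ V] (b : Module.Basis I ℂ V) (deg : I → ℕ)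

/-- The word `v_{i₁} ⋯ v_{iₗ}` in the basis vectors. -/
def word (w : List I) : TensorAlgebra ℂ V := (w.map fun i => TensorAlgebra.ι ℂ (b i)).prod

theorem tensorAlgebra_basis_apply (w : FreeMonoid I) : b.tensorAlgebra w = word b w.toList := by
  have h : b.tensorAlgebra w =
      (TensorAlgebra.equivFreeAlgebra b).symm (FreeAlgebra.basisFreeMonoid ℂ I w) := rfl
  rw [h]
  have h2 : FreeAlgebra.basisFreeMonoid ℂ I w = (w.toList.map (FreeAlgebra.ι ℂ)).prod := by
    have h3 : FreeAlgebra.basisFreeMonoid ℂ I w =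
        FreeAlgebra.equivMonoidAlgebraFreeMonoid.symm (MonoidAlgebra.single w (1 : ℂ)) := by
      simp [FreeAlgebra.basisFreeMonoid]
    rw [h3]
    change MonoidAlgebra.lift ℂ (FreeAlgebra ℂ I) (FreeMonoid I)
      (FreeMonoid.lift (FreeAlgebra.ι ℂ)) (MonoidAlgebra.single w (1 : ℂ)) = _
    rw [MonoidAlgebra.lift_single, one_smul, FreeMonoid.lift_apply]
  rw [h2, map_list_prod, List.map_map, word]
  congr 2
  funext i
  simp

/-- The component of degree `n` of the tensor algebra, where the basis vector `v_i` has degree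
`deg i`. -/
def tensorGrading (n : ℕ) : Submodule ℂ (TensorAlgebra ℂ V) :=
  Submodule.span ℂ {x | ∃ w : List I, (w.map deg).sum = n ∧ x = word b w}

open Classical in
/-- The linear map `Θ_{T(V)}`: on the basis of words, it multiplies a word of length `ℓ` whose
letters all have odd degree by `2 ^ ℓ`, and maps the other words to `0`. -/
def thetaTensor : TensorAlgebra ℂ V →ₗ[ℂ] TensorAlgebra ℂ V :=
  b.tensorAlgebra.constr ℂ fun w =>
    if ∀ i ∈ w.toList, Odd (deg i) then (2 : ℂ) ^ w.toList.length • word b w.toList else 0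

open Classical in
theorem thetaTensor_word (w : List I) :
    thetaTensor b deg (word b w) =
      if ∀ i ∈ w, Odd (deg i) then (2 : ℂ) ^ w.length • word b w else 0 := by
  have h := tensorAlgebra_basis_apply b (FreeMonoid.ofList w)
  rw [FreeMonoid.toList_ofList] at h
  rw [thetaTensor, ← h, Module.Basis.constr_basis, FreeMonoid.toList_ofList, h]

/-- The subspace `O(V)` of `V` spanned by the basis vectors of odd degree. -/
def oddSubspace : Submodule ℂ V := Submodule.span ℂ (b '' {i | Odd (deg i)})

/-- The tensor algebra `T(O(V))`, as a subalgebra of `T(V)`. -/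
def tensorOdd : Subalgebra ℂ (TensorAlgebra ℂ V) :=
  (TensorAlgebra.lift ℂ (TensorAlgebra.ι ℂ ∘ₗ (oddSubspace b deg).subtype)).range

/-- The algebra morphism `Φ_{T(V)} : T(V) → Sym` with `v_i ↦ p_{deg i}`. -/
def phiTensor : TensorAlgebra ℂ V →ₐ[ℂ] SymFun :=
  TensorAlgebra.lift ℂ (b.constr ℂ fun i => scaledPowerSum (deg i))

/-- The canonical character `ζ_{T(V)} = ζ_Sym ∘ Φ_{T(V)}` of the tensor algebra. -/
def zetaTensor : TensorAlgebra ℂ V →ₐ[ℂ] ℂ := zetaSym.comp (phiTensor b deg)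

end TensorTheta

end PeakAlgebra

end

noncomputable section

namespace PeakAlgebra

open scoped TensorProduct
open WithConv

/-! ### Exponents as iterated juxtapositions -/

section Exponents

/-! The tensor algebra is free on primitive generators, and each theta map acts on a homogeneous
primitive element of degree `n` as the scalar `1 - (-1) ^ n`, which is `2` for odd `n` and `0` for
even `n`. Indeed a character of the form `ξ * η` is additive on primitives, `(ξ * η) x = ξ x + η x`,
so the inverse of a character is its negative there, and the odd character takes the value `(1 -
(-1) ^ n) ζ(x)` at `x`. The image of `x` under the theta map is again primitive of degree `n`, and a
homogeneous primitive series is determined by its value at `(1, 0, 0, …)` (`eq_of_primitive`). This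
gives `theta_qsym_of_isPrimitive` and `theta_sym_of_isPrimitive`.

Since `Θ_{T(V)}` is the algebra morphism which rescales each generator by that same factor
(`toLinearMap_thetaTensorHom`), and power sums are primitive, both sides of `Φ ∘ Θ_{T(V)} = Θ ∘ Φ`
are algebra morphisms which agree on generators (`comp_thetaTensor_eq`). That the maps are Hopf
morphisms is likewise checked on generators (`isGradedHopfMorphism_of_primitive`).

The remaining content is that the universal morphisms exist and are unique. The coefficient of
`x₀^{a₁} ⋯ x_{k-1}^{aₖ}` in `Ψ(h)` has to be `(ζ_{a₁} * ⋯ * ζ_{aₖ})(h)`, where `ζ_a` is the degree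
`a` part of the character, because the coproduct separates alphabets and a power of one variable is
read off by `ζ`. This forces uniqueness (`combHopfMorphism_qsym_unique`). Conversely these
convolution products define a morphism (`exists_algHom_of_conv_family`). For `Sym` the product must
not depend on the order of the parts, which is where cocommutativity enters. Both cases are treated
at once: the types of exponents form a monoid `I`, and a multiplicative family of linear forms
indexed by `I` is what is needed. Properties of all coefficients then follow by `join_induction`
from those of powers of a single variable. -/

theorem join_single_comapDomain (m : ℕ →₀ ℕ) :
    join 1 (Finsupp.single 0 (m 0))
      (m.comapDomain (addRightEmbedding 1) (addRightEmbedding 1).injective.injOn) = m := by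
  ext j
  rw [join, Finsupp.add_apply]
  rcases j with _ | j
  · rw [Finsupp.single_eq_same, Finsupp.embDomain_of_notMem_range, add_zero]
    rintro ⟨k, hk⟩
    simp at hk
  · rw [Finsupp.single_eq_of_ne (by omega), zero_add]
    exact Finsupp.embDomain_apply_self (addRightEmbedding 1) _ j

/-- Every exponent is obtained from exponents of powers of the first variable by juxtaposition. -/
theorem join_induction {P : (ℕ →₀ ℕ) → Prop} (single : ∀ a, P (Finsupp.single 0 a))
    (join : ∀ N m m', (∀ j ∈ m.support, j < N) → P m → P m' → P (join N m m')) (m : ℕ →₀ ℕ) :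
    P m := by
  obtain ⟨N, hN⟩ := TypeData.exists_bound m
  induction N generalizing m with
  | zero =>
    have : m = Finsupp.single 0 0 := by
      rw [Finsupp.single_zero, ← Finsupp.support_eq_empty, Finset.eq_empty_iff_forall_notMem]
      exact fun j hj => Nat.not_lt_zero _ (hN j hj)
    exact this ▸ single 0
  | succ N ih =>
    -- Split off the first variable; the remaining exponent, shifted down by one, is supported below
    -- `N`.
    rw [← join_single_comapDomain m]
    refine join 1 _ _ (fun j hj => ?_) (single _) (ih _ fun j hj => ?_)
    · have := Finsupp.support_single_subset hj
      simp at this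
      omega
    · rw [Finsupp.mem_support_iff, Finsupp.comapDomain_apply, ← Finsupp.mem_support_iff] at hj
      have := hN _ hj
      simp at this
      omega

theorem expList_single (k : ℕ+) : expList (Finsupp.single 0 (k : ℕ)) = [k] := by
  rw [expList, Finsupp.support_single _ k.ne_zero]
  simp

theorem degree_join (N : ℕ) (m m' : ℕ →₀ ℕ) : (join N m m').degree = m.degree + m'.degree := by
  rw [join, map_add, Finsupp.embDomain_eq_mapDomain, Finsupp.degree_mapDomain]

theorem support_subset_of_mem_antidiagonal {m : ℕ →₀ ℕ} {p : (ℕ →₀ ℕ) × (ℕ →₀ ℕ)}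
    (hp : p ∈ Finset.HasAntidiagonal.antidiagonal m) {N : ℕ} (hm : ∀ j ∈ m.support, j < N) :
    (∀ j ∈ p.1.support, j < N) ∧ ∀ j ∈ p.2.support, j < N := by
  have hp' := Finset.HasAntidiagonal.mem_antidiagonal.mp hp
  constructor <;>
  · intro j hj
    refine hm j ?_
    rw [← hp', Finsupp.mem_support_iff, Finsupp.add_apply]
    rw [Finsupp.mem_support_iff] at hj
    omega

end Exponents

/-! ### Morphisms from multiplicative families of linear forms -/

section Existence

variable {S : Set (ℕ ↪ ℕ)} {I : Type} [AddMonoid I]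
variable {H J : Type*} [Ring H] [Bialgebra ℂ H]

/-- Convolution of linear forms on a basis with an explicit coproduct. -/
theorem convMul_form_basis {e : Module.Basis J ℂ H} {cuts : J → Finset (J × J)}
    (hΔ : ∀ i, Coalgebra.comul (R := ℂ) (e i) = ∑ p ∈ cuts i, e p.1 ⊗ₜ[ℂ] e p.2)
    (f g : WithConv (H →ₗ[ℂ] ℂ)) (i : J) :
    (f * g).ofConv (e i) = ∑ p ∈ cuts i, f.ofConv (e p.1) * g.ofConv (e p.2) := by
  rw [LinearMap.convMul_apply, hΔ, map_sum, map_sum]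
  simp

/-- Linear forms `F i`, multiplicative in `i` for the convolution product, are homogeneous as soon
as they are so for the exponents of powers of the first variable. -/
theorem conv_family_eq_zero (D : TypeData S I) {e : Module.Basis J ℂ H} {wt : J → ℕ}
    {cuts : J → Finset (J × J)}
    (hΔ : ∀ i, Coalgebra.comul (R := ℂ) (e i) = ∑ p ∈ cuts i, e p.1 ⊗ₜ[ℂ] e p.2)
    (hwt : ∀ i, ∀ p ∈ cuts i, wt p.1 + wt p.2 = wt i)
    (F : I → WithConv (H →ₗ[ℂ] ℂ)) (hadd : ∀ i j, F (i + j) = F i * F j)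
    (hdeg : ∀ a j, wt j ≠ a → (F (D.typ (Finsupp.single 0 a))).ofConv (e j) = 0)
    (m : ℕ →₀ ℕ) : ∀ j, wt j ≠ m.degree → (F (D.typ m)).ofConv (e j) = 0 := by
  induction m using join_induction with
  | single a =>
    intro j hj
    exact hdeg a j (by simpa using hj)
  | join N m m' hm h h' =>
    intro j hj
    rw [D.typ_join N m m' hm, hadd, convMul_form_basis hΔ]
    refine Finset.sum_eq_zero fun p hp => ?_
    rw [degree_join] at hj
    -- The weights of the two factors add up to `wt j`, which differs from `m.degree + m'.degree`;
    -- hence one of the factors has the wrong weight.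
    have := hwt j p hp
    by_cases h1 : wt p.1 = m.degree
    · rw [h' _ (by omega), mul_zero]
    · rw [h _ h1, zero_mul]

/-- Linear forms `F i`, multiplicative in `i` for the convolution product, satisfy the Leibniz rule
as soon as they do so for the exponents of powers of the first variable. -/
theorem conv_family_mul (D : TypeData S I) (F : I → WithConv (H →ₗ[ℂ] ℂ))
    (hadd : ∀ i j, F (i + j) = F i * F j)
    (hmul : ∀ a f g, (F (D.typ (Finsupp.single 0 a))).ofConv (f * g) =
      ∑ p ∈ Finset.HasAntidiagonal.antidiagonal a,
        (F (D.typ (Finsupp.single 0 p.1))).ofConv f * (F (D.typ (Finsupp.single 0 p.2))).ofConv g)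
    (m : ℕ →₀ ℕ) : ∀ f g, (F (D.typ m)).ofConv (f * g) =
      ∑ p ∈ Finset.HasAntidiagonal.antidiagonal m,
        (F (D.typ p.1)).ofConv f * (F (D.typ p.2)).ofConv g := by
  induction m using join_induction with
  | single a =>
    intro f g
    rw [hmul, Finsupp.antidiagonal_single, Finset.sum_map]
    rfl
  | join N m m' hm h h' =>
    intro f g
    rw [D.typ_join N m m' hm, hadd, sum_antidiagonal_join N m m' hm
      (fun x y => (F (D.typ x)).ofConv f * (F (D.typ y)).ofConv g), LinearMap.convMul_apply,
      Bialgebra.comul_mul]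
    -- This is applied to `X = Δ f` and `Y = Δ g`, using that `Δ` is multiplicative. By bilinearity
    -- it reduces to pure tensors, where it is the product of the two induction hypotheses.
    have key : ∀ X Y : H ⊗[ℂ] H,
        LinearMap.mul' ℂ ℂ (TensorProduct.map (F (D.typ m)).ofConv (F (D.typ m')).ofConv (X * Y)) =
          ∑ a ∈ Finset.HasAntidiagonal.antidiagonal m,
            ∑ b ∈ Finset.HasAntidiagonal.antidiagonal m',
              LinearMap.mul' ℂ ℂ (TensorProduct.map (F (D.typ a.1)).ofConv
                (F (D.typ b.1)).ofConv X) *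
              LinearMap.mul' ℂ ℂ (TensorProduct.map (F (D.typ a.2)).ofConv
                (F (D.typ b.2)).ofConv Y) := by
      intro X Y
      induction X using TensorProduct.induction_on with
      | zero => simp
      | add X X' hX hX' => simp only [add_mul, map_add, hX, hX', Finset.sum_add_distrib]
      | tmul x y =>
        induction Y using TensorProduct.induction_on with
        | zero => simp
        | add Y Y' hY hY' => simp only [mul_add, map_add, hY, hY', Finset.sum_add_distrib]
        | tmul x' y' =>
          simp only [Algebra.TensorProduct.tmul_mul_tmul, TensorProduct.map_tmul,
            LinearMap.mul'_apply]
          rw [h, h', Finset.sum_mul_sum]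
          exact Finset.sum_congr rfl fun a _ => Finset.sum_congr rfl fun b _ => by ring
    rw [key]
    refine Finset.sum_congr rfl fun a ha => Finset.sum_congr rfl fun b _ => ?_
    -- Both parts of a decomposition of `m` are still supported below `N`, so juxtaposition with the
    -- parts of `m'` is again turned into a convolution product.
    obtain ⟨h1, h2⟩ := support_subset_of_mem_antidiagonal ha hm
    rw [D.typ_join N _ _ h1, D.typ_join N _ _ h2, hadd, hadd]
    rfl

/-- The algebra morphism to `invSeries S` whose coefficients are given by linear forms `F i`,
multiplicative in `i` for the convolution product. -/
theorem exists_algHom_of_conv_family (D : TypeData S I) {e : Module.Basis J ℂ H} {wt : J → ℕ}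
    {cuts : J → Finset (J × J)}
    (hΔ : ∀ i, Coalgebra.comul (R := ℂ) (e i) = ∑ p ∈ cuts i, e p.1 ⊗ₜ[ℂ] e p.2)
    (hwt : ∀ i, ∀ p ∈ cuts i, wt p.1 + wt p.2 = wt i)
    {j₀ : J} (hone : e j₀ = 1) (hj₀ : wt j₀ = 0)
    (F : I → WithConv (H →ₗ[ℂ] ℂ)) (hzero : F 0 = 1) (hadd : ∀ i j, F (i + j) = F i * F j)
    (hdeg : ∀ a j, wt j ≠ a → (F (D.typ (Finsupp.single 0 a))).ofConv (e j) = 0)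
    (hmul : ∀ a f g, (F (D.typ (Finsupp.single 0 a))).ofConv (f * g) =
      ∑ p ∈ Finset.HasAntidiagonal.antidiagonal a,
        (F (D.typ (Finsupp.single 0 p.1))).ofConv f *
          (F (D.typ (Finsupp.single 0 p.2))).ofConv g) :
    ∃ Ψ : H →ₐ[ℂ] invSeries S, (∀ m h, cf m (Ψ h) = (F (D.typ m)).ofConv h) ∧
      (∀ h, D.comulLin (Ψ h) =
        TensorProduct.map Ψ.toLinearMap Ψ.toLinearMap (Coalgebra.comul (R := ℂ) h)) ∧
      ∀ h, cf 0 (Ψ h) = Coalgebra.counit (R := ℂ) h := by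
  have hdeg' := conv_family_eq_zero D hΔ hwt F hadd hdeg
  -- The series has bounded degree because `h` is a finite combination of basis elements, each of
  -- which contributes only to exponents of degree equal to its weight.
  have hbound : ∀ h : H, ∃ d, ∀ m : ℕ →₀ ℕ, d < m.degree → (F (D.typ m)).ofConv h = 0 := by
    intro h
    have hh : h ∈ Submodule.span ℂ (Set.range e) := e.mem_span h
    induction hh using Submodule.span_induction with
    | mem h hh =>
      obtain ⟨j, rfl⟩ := hh
      exact ⟨wt j, fun m hm => hdeg' m j hm.ne⟩
    | zero => exact ⟨0, fun m _ => map_zero _⟩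
    | add f g _ _ hf hg =>
      obtain ⟨d, hd⟩ := hf
      obtain ⟨d', hd'⟩ := hg
      refine ⟨max d d', fun m hm => ?_⟩
      rw [map_add, hd m (lt_of_le_of_lt (le_max_left _ _) hm),
        hd' m (lt_of_le_of_lt (le_max_right _ _) hm), add_zero]
    | smul c f _ hf =>
      obtain ⟨d, hd⟩ := hf
      exact ⟨d, fun m hm => by rw [map_smul, hd m hm, smul_zero]⟩
  let Ψl : H →ₗ[ℂ] invSeries S :=
    { toFun := fun h => ⟨fun m => (F (D.typ m)).ofConv h, hbound h, fun φ hφ m => by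
        change (F (D.typ (m.embDomain φ))).ofConv h = (F (D.typ m)).ofConv h
        rw [D.typ_embDomain φ hφ]⟩
      map_add' := fun f g => invSeries_ext fun m => map_add (F (D.typ m)).ofConv f g
      map_smul' := fun c f => invSeries_ext fun m => map_smul (F (D.typ m)).ofConv c f }
  have hcf : ∀ m h, cf m (Ψl h) = (F (D.typ m)).ofConv h := fun _ _ => rfl
  have hmul' := conv_family_mul D F hadd hmul
  have hF0 : ∀ h, (F (D.typ 0)).ofConv h = Coalgebra.counit (R := ℂ) h := fun h => by
    rw [D.typ_zero, hzero]
    rfl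
  let Ψ : H →ₐ[ℂ] invSeries S := AlgHom.ofLinearMap Ψl
    (invSeries_ext fun m => by
      rw [hcf, cf_one]
      split_ifs with hm
      · rw [hm, hF0, Bialgebra.counit_one]
      -- The unit is the basis element `e j₀` of weight `0`, so its coefficients in positive degree
      -- vanish.
      · have h1 : (m.degree) ≠ 0 := fun h => hm ((Finsupp.degree_eq_zero_iff m).mp h)
        rw [← hone]
        exact hdeg' m j₀ (hj₀ ▸ h1.symm))
    (fun f g => invSeries_ext fun m => by
      rw [cf_mul]
      exact hmul' m f g)
  refine ⟨Ψ, hcf, fun h => D.tensor_ext fun m m' => ?_, fun h => hF0 h⟩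
  obtain ⟨N, hN⟩ := TypeData.exists_bound m
  -- On the left, the coefficient of the coproduct at `(m, m')` is the coefficient at the juxtaposed
  -- exponent, that is, `F (D.typ m) * F (D.typ m')`. By definition of convolution this is the
  -- coefficient of `(Ψ ⊗ Ψ) Δ h` on the right.
  rw [D.cf₂_comulLin hN]
  refine (hcf _ h).trans ?_
  rw [D.typ_join N m m' hN, hadd, LinearMap.convMul_apply, cf₂, LinearMap.comp_apply,
    ← LinearMap.comp_apply (TensorProduct.map (cf m) (cf m')), ← TensorProduct.map_comp]
  rfl

end Existence

/-! ### Homogeneous components of series -/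

section Homogeneous

variable {S : Set (ℕ ↪ ℕ)} {I : Type} [AddMonoid I]

/-- The projection onto the homogeneous component of degree `n`. -/
def homogeneousProj (n : ℕ) : invSeries S →ₗ[ℂ] invSeries S where
  toFun f := ⟨fun m => if m.degree = n then cf m f else 0,
    ⟨n, fun _ hm => if_neg hm.ne'⟩, fun φ hφ m => by
      change (if (m.embDomain φ).degree = n then cf (m.embDomain φ) f else 0) =
        if m.degree = n then cf m f else 0
      rw [Finsupp.embDomain_eq_mapDomain, Finsupp.degree_mapDomain,
        ← Finsupp.embDomain_eq_mapDomain, show cf (m.embDomain φ) f = cf m f from f.2.2 φ hφ m]⟩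
  map_add' f g := invSeries_ext fun m => by
    change (if m.degree = n then cf m (f + g) else 0) =
      (if m.degree = n then cf m f else 0) + if m.degree = n then cf m g else 0
    split_ifs <;> simp
  map_smul' c f := invSeries_ext fun m => by
    change (if m.degree = n then cf m (c • f) else 0) =
      c * if m.degree = n then cf m f else 0
    split_ifs <;> simp

theorem cf_homogeneousProj (n : ℕ) (m : ℕ →₀ ℕ) (f : invSeries S) :
    cf m (homogeneousProj n f) = if m.degree = n then cf m f else 0 := rfl

theorem homogeneousProj_zero (f : invSeries S) :
    homogeneousProj 0 f = algebraMap ℂ (invSeries S) (cf 0 f) := by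
  refine invSeries_ext fun m => ?_
  rw [cf_homogeneousProj, Algebra.algebraMap_eq_smul_one, map_smul, cf_one]
  simp only [Finsupp.degree_eq_zero_iff]
  split_ifs with h <;> simp [h]

theorem homogeneousProj_of_mem {n : ℕ} {f : invSeries S} (hf : f ∈ homogeneous S n) (a : ℕ) :
    homogeneousProj a f = if n = a then f else 0 := by
  refine invSeries_ext fun m => ?_
  rw [cf_homogeneousProj]
  split_ifs with h h' h'
  · rfl
  · rw [hf m (by omega), map_zero]
  · exact (hf m (by omega)).symm
  · rw [map_zero]

theorem homogeneousProj_mul (n : ℕ) (f g : invSeries S) :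
    homogeneousProj n (f * g) = ∑ p ∈ Finset.HasAntidiagonal.antidiagonal n,
      homogeneousProj p.1 f * homogeneousProj p.2 g := by
  refine invSeries_ext fun m => ?_
  rw [cf_homogeneousProj, map_sum]
  simp only [cf_mul]
  symm
  rw [Finset.sum_comm]
  -- After exchanging the sums, a fixed decomposition `q` of `m` is seen only by the pair of degrees
  -- `(q.1.degree, q.2.degree)`, which lies over `n` exactly when `m` has degree `n`.
  refine (Finset.sum_congr rfl (g := fun q => if m.degree = n then cf q.1 f * cf q.2 g else 0)
    fun q hq => ?_).trans ?_
  rotate_left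
  · split_ifs <;> simp
  · have hd : q.1.degree + q.2.degree = m.degree := by
      rw [← map_add, Finset.HasAntidiagonal.mem_antidiagonal.mp hq]
    simp only [cf_homogeneousProj]
    split_ifs with h
    · rw [Finset.sum_eq_single (q.1.degree, q.2.degree)]
      · simp
      · rintro ⟨a, b⟩ - hab
        rw [ite_mul, zero_mul]
        split_ifs with h1 h2
        · exact absurd (by rw [h1, h2]) hab
        · rw [mul_zero]
        · rfl
      · intro h'
        exact absurd (Finset.HasAntidiagonal.mem_antidiagonal.mpr (by simp; omega)) h'
    · refine Finset.sum_eq_zero fun p hp => ?_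
      have := Finset.HasAntidiagonal.mem_antidiagonal.mp hp
      split_ifs with h1 h2
      · omega
      · rw [mul_zero]
      · rw [zero_mul]
      · rw [zero_mul]

theorem mono_mem_homogeneous (D : TypeData S I) (i : I) : D.mono i ∈ homogeneous S (D.wt i) := by
  intro m hm
  rw [D.cf_mono, if_neg]
  rintro rfl
  exact hm (D.wt_typ m).symm

theorem homogeneous_le_span (D : TypeData S I) (n : ℕ) :
    homogeneous S n ≤ Submodule.span ℂ (D.mono '' {i | D.wt i = n}) := by
  intro f hf
  rw [← D.basis.linearCombination_repr f, Finsupp.linearCombination_apply]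
  refine Submodule.sum_mem _ fun i hi => Submodule.smul_mem _ _ (Submodule.subset_span ⟨i, ?_, ?_⟩)
  · by_contra h
    rw [Finsupp.mem_support_iff, D.basis_repr] at hi
    refine hi (hf _ ?_)
    rw [← D.wt_typ, D.typ_rep]
    exact h
  · rw [D.basis_apply]

theorem mul_mem_homogeneous {i j : ℕ} {f g : invSeries S} (hf : f ∈ homogeneous S i)
    (hg : g ∈ homogeneous S j) : f * g ∈ homogeneous S (i + j) := by
  intro m hm
  rw [cf_mul]
  refine Finset.sum_eq_zero fun p hp => ?_
  have hd : p.1.degree + p.2.degree = m.degree := by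
    rw [← map_add, Finset.HasAntidiagonal.mem_antidiagonal.mp hp]
  by_cases h : p.1.degree = i
  · rw [hg p.2 (by omega), mul_zero]
  · rw [hf p.1 h, zero_mul]

theorem one_mem_homogeneous : (1 : invSeries S) ∈ homogeneous S 0 := by
  intro m hm
  rw [cf_one, if_neg]
  rintro rfl
  simp at hm

theorem iSup_homogeneous (D : TypeData S I) : ⨆ n, homogeneous S n = ⊤ := by
  rw [eq_top_iff, ← D.basis.span_eq, Submodule.span_le]
  rintro _ ⟨i, rfl⟩
  rw [D.basis_apply]
  exact Submodule.mem_iSup_of_mem _ (mono_mem_homogeneous D i)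

/-- The specialization `f ↦ f(1, 0, 0, …)` of a homogeneous series. -/
theorem aeval_toPoly_of_homogeneous {n : ℕ} {f : invSeries S} (hf : f ∈ homogeneous S n) :
    Polynomial.aeval (1 : ℂ) (toPoly f) = cf (Finsupp.single 0 n) f := by
  have h : toPoly f = Polynomial.monomial n (cf (Finsupp.single 0 n) f) := by
    ext k
    rw [Polynomial.coeff_monomial]
    refine (coeff_toPolyFun f k).trans ?_
    split_ifs with hk
    · rw [hk]
    · exact hf _ (by simpa using Ne.symm hk)
  rw [h, Polynomial.aeval_monomial]
  simp

end Homogeneous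

/-! ### Existence of morphisms with a prescribed character -/

section Universal

variable {S : Set (ℕ ↪ ℕ)} {I : Type} [AddMonoid I]
variable {H J : Type*} [Ring H] [Bialgebra ℂ H]

/-- Existence of a morphism to `invSeries S` inducing a given character. -/
theorem exists_algHom_of_char (D : TypeData S I) {e : Module.Basis J ℂ H} {wt : J → ℕ}
    {cuts : J → Finset (J × J)}
    (hΔ : ∀ i, Coalgebra.comul (R := ℂ) (e i) = ∑ p ∈ cuts i, e p.1 ⊗ₜ[ℂ] e p.2)
    (hwt : ∀ i, ∀ p ∈ cuts i, wt p.1 + wt p.2 = wt i)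
    {j₀ : J} (hone : e j₀ = 1) (hj₀ : wt j₀ = 0)
    (ζ : H →ₐ[ℂ] ℂ) (z : ℕ → H →ₗ[ℂ] ℂ)
    (hz : ∀ a j, z a (e j) = if wt j = a then ζ (e j) else 0)
    (hzmul : ∀ a f g, z a (f * g) = ∑ p ∈ Finset.HasAntidiagonal.antidiagonal a, z p.1 f * z p.2 g)
    (F : I → WithConv (H →ₗ[ℂ] ℂ)) (hzero : F 0 = 1) (hadd : ∀ i j, F (i + j) = F i * F j)
    (hF : ∀ a, F (D.typ (Finsupp.single 0 a)) = toConv (z a)) :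
    ∃ Ψ : H →ₐ[ℂ] invSeries S,
      (∀ h, D.comulLin (Ψ h) =
        TensorProduct.map Ψ.toLinearMap Ψ.toLinearMap (Coalgebra.comul (R := ℂ) h)) ∧
      (∀ h, cf 0 (Ψ h) = Coalgebra.counit (R := ℂ) h) ∧
      (∀ j, Ψ (e j) ∈ homogeneous S (wt j)) ∧
      ∀ h, Polynomial.aeval (1 : ℂ) (toPoly (Ψ h)) = ζ h := by
  have hdeg : ∀ a j, wt j ≠ a → (F (D.typ (Finsupp.single 0 a))).ofConv (e j) = 0 := by
    intro a j h
    rw [hF]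
    exact (hz a j).trans (if_neg h)
  obtain ⟨Ψ, hcf, hcomul, hcounit⟩ := exists_algHom_of_conv_family D hΔ hwt hone hj₀ F hzero hadd
    hdeg (fun a f g => by simp only [hF]; exact hzmul a f g)
  have hhom : ∀ j, Ψ (e j) ∈ homogeneous S (wt j) := fun j m hm => by
    rw [hcf]
    exact conv_family_eq_zero D hΔ hwt F hadd hdeg m j hm.symm
  refine ⟨Ψ, hcomul, hcounit, hhom, fun h => ?_⟩
  -- On `e j` the specialization picks out the coefficient of the power of the first variable of
  -- degree `wt j`, which is `z (wt j) (e j) = ζ (e j)`.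
  have key : ((Polynomial.aeval (1 : ℂ)).comp (toPoly.comp Ψ)).toLinearMap = ζ.toLinearMap :=
    e.ext fun j => by
      change Polynomial.aeval (1 : ℂ) (toPoly (Ψ (e j))) = ζ (e j)
      rw [aeval_toPoly_of_homogeneous (hhom j), hcf, hF]
      exact (hz _ j).trans (if_pos rfl)
  exact congrArg (fun f => f h) key

variable {S' : Set (ℕ ↪ ℕ)} {I' : Type} [AddMonoid I']

/-- The degree `n` part of a character. -/
def charPart (ζ : invSeries S' →ₐ[ℂ] ℂ) (n : ℕ) : invSeries S' →ₗ[ℂ] ℂ :=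
  ζ.toLinearMap ∘ₗ homogeneousProj n

/-- The component of degree `0` consists of scalars, on which every character is the identity. So
all characters share the counit as their degree `0` part. -/
theorem charPart_zero (ζ : invSeries S' →ₐ[ℂ] ℂ) : charPart ζ 0 = cf 0 := by
  ext f
  rw [charPart, LinearMap.comp_apply, homogeneousProj_zero]
  exact ζ.commutes _

theorem charPart_basis (ζ : invSeries S' →ₐ[ℂ] ℂ) (D : TypeData S' I') (a : ℕ) (j : I') :
    charPart ζ a (D.basis j) = if D.wt j = a then ζ (D.basis j) else 0 := by
  rw [D.basis_apply, charPart, LinearMap.comp_apply,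
    homogeneousProj_of_mem (mono_mem_homogeneous D j)]
  split_ifs
  · rfl
  · exact map_zero ζ

theorem charPart_mul (ζ : invSeries S' →ₐ[ℂ] ℂ) (a : ℕ) (f g : invSeries S') :
    charPart ζ a (f * g) = ∑ p ∈ Finset.HasAntidiagonal.antidiagonal a,
      charPart ζ p.1 f * charPart ζ p.2 g := by
  simp only [charPart, LinearMap.comp_apply, homogeneousProj_mul, AlgHom.toLinearMap_apply,
    map_sum, map_mul]

theorem map_mem_homogeneous (D : TypeData S' I') {f : invSeries S' →ₗ[ℂ] invSeries S}
    (h : ∀ j, f (D.basis j) ∈ homogeneous S (D.wt j)) (n : ℕ) :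
    ∀ x ∈ homogeneous S' n, f x ∈ homogeneous S n := by
  intro x hx
  refine (Submodule.span_le (p := (homogeneous S n).comap f)).mpr ?_ (homogeneous_le_span D n hx)
  rintro _ ⟨j, rfl, rfl⟩
  have := h j
  rwa [D.basis_apply] at this

/-- Addition of multisets is commutative, so swapping the two halves permutes the cuts of a
partition. The consequence needed below is that convolution of linear forms on `SymFun` is
commutative. -/
instance symCocomm : Coalgebra.IsCocomm ℂ SymFun where
  comm_comp_comul := by
    refine symData.basis.ext fun i => ?_
    rw [symData.basis_apply]
    change TensorProduct.comm ℂ _ _ (symData.comulLin (symData.mono i)) =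
      symData.comulLin (symData.mono i)
    rw [symData.comulLin_mono, map_sum]
    refine Finset.sum_nbij' Prod.swap Prod.swap ?_ ?_ ?_ ?_ ?_
    · intro p hp
      rw [TypeData.mem_cuts] at hp ⊢
      exact (add_comm _ _).trans hp
    · intro p hp
      rw [TypeData.mem_cuts] at hp ⊢
      exact (add_comm _ _).trans hp
    · intro p _
      rfl
    · intro p _
      rfl
    · intro p _
      rfl

theorem qsymData_typ_single (k : ℕ+) :
    qsymData.typ (Finsupp.single 0 (k : ℕ)) = FreeAddMonoid.of k :=
  congrArg FreeAddMonoid.ofList (expList_single k)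

theorem symData_typ_single (k : ℕ+) :
    symData.typ (Finsupp.single 0 (k : ℕ)) = {k} :=
  congrArg (fun l : List ℕ+ => (l : Multiset ℕ+)) (expList_single k)

/-- Compositions form the free monoid on the positive integers, so the assignment `a ↦ ζ_a` extends
to a multiplicative family without any condition. -/
theorem exists_combHopfMorphism_qsym (ζ : QSym →ₐ[ℂ] ℂ) :
    ∃ Ψ : QSym →ₗ[ℂ] QSym,
      IsCombHopfMorphism (homogeneous _) ζ (homogeneous _) zetaQSym Ψ := by
  obtain ⟨Ψ, hcomul, hcounit, hhom, hζ⟩ := exists_algHom_of_char qsymData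
    (e := qsymData.basis) (wt := qsymData.wt) (cuts := qsymData.cuts)
    (fun i => by simp only [qsymData.basis_apply]; exact comul_qsym_mono i)
    (fun i p hp => by rw [← map_add, qsymData.mem_cuts.mp hp])
    ((qsymData.basis_apply 0).trans qsymData.mono_zero) (map_zero _) ζ (charPart ζ)
    (charPart_basis ζ qsymData) (charPart_mul ζ)
    (fun α => (α.toList.map fun a : ℕ+ => toConv (charPart ζ (a : ℕ))).prod) rfl
    (fun α β => by
      rw [FreeAddMonoid.toList_add, List.map_append, List.prod_append])
    (fun a => by
      -- Parts of a composition are positive, so `a = 0` gives the empty composition and the empty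
      -- product; this matches because `ζ_0` is the counit, the unit for convolution.
      rcases Nat.eq_zero_or_pos a with rfl | ha
      · rw [Finsupp.single_zero, qsymData.typ_zero, charPart_zero]
        rfl
      · obtain ⟨k, rfl⟩ : ∃ k : ℕ+, (k : ℕ) = a := ⟨⟨a, ha⟩, rfl⟩
        rw [qsymData_typ_single]
        simp)
  refine ⟨Ψ.toLinearMap, ⟨⟨BialgHom.ofAlgHom Ψ (AlgHom.ext hcounit)
    (AlgHom.ext fun h => (hcomul h).symm), fun _ => rfl⟩, ?_⟩, hζ⟩
  exact map_mem_homogeneous qsymData hhom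

/-- Partitions form the free commutative monoid on the positive integers, so the forms `ζ_a` have to
commute under convolution; this is provided by `symCocomm`. -/
theorem exists_combHopfMorphism_sym (ζ : SymFun →ₐ[ℂ] ℂ) :
    ∃ Ψ : SymFun →ₗ[ℂ] SymFun,
      IsCombHopfMorphism (homogeneous _) ζ (homogeneous _) zetaSym Ψ := by
  obtain ⟨Ψ, hcomul, hcounit, hhom, hζ⟩ := exists_algHom_of_char symData
    (e := symData.basis) (wt := symData.wt) (cuts := symData.cuts)
    (fun i => by simp only [symData.basis_apply]; exact symData.comulLin_mono i)
    (fun i p hp => by rw [← map_add, symData.mem_cuts.mp hp])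
    ((symData.basis_apply 0).trans symData.mono_zero) (map_zero _) ζ (charPart ζ)
    (charPart_basis ζ symData) (charPart_mul ζ)
    (fun μ => (μ.map fun a : ℕ+ => toConv (charPart ζ (a : ℕ))).prod) (by simp)
    (fun μ ν => by
      rw [Multiset.map_add, Multiset.prod_add])
    (fun a => by
      rcases Nat.eq_zero_or_pos a with rfl | ha
      · rw [Finsupp.single_zero, symData.typ_zero, charPart_zero]
        rfl
      · obtain ⟨k, rfl⟩ : ∃ k : ℕ+, (k : ℕ) = a := ⟨⟨a, ha⟩, rfl⟩
        rw [symData_typ_single]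
        simp)
  refine ⟨Ψ.toLinearMap, ⟨⟨BialgHom.ofAlgHom Ψ (AlgHom.ext hcounit)
    (AlgHom.ext fun h => (hcomul h).symm), fun _ => rfl⟩, ?_⟩, hζ⟩
  exact map_mem_homogeneous symData hhom

end Universal

/-! ### Uniqueness of morphisms, and the theta maps of `QSym` and `Sym` -/

section Uniqueness

variable {H : Type*} [Ring H] [HopfAlgebra ℂ H]

/-- Coefficients at powers of the first variable are forced by the character and the degrees, and
those at a juxtaposed exponent are forced, through compatibility with the coproduct, by those at its
two pieces. -/
theorem combHopfMorphism_qsym_unique {𝒜 : ℕ → Submodule ℂ H} (h𝒜 : ⨆ n, 𝒜 n = ⊤)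
    {ζ : H →ₐ[ℂ] ℂ} {f g : H →ₗ[ℂ] QSym}
    (hf : IsCombHopfMorphism 𝒜 ζ (homogeneous _) zetaQSym f)
    (hg : IsCombHopfMorphism 𝒜 ζ (homogeneous _) zetaQSym g) : f = g := by
  have hsingle : ∀ {f : H →ₗ[ℂ] QSym}, IsCombHopfMorphism 𝒜 ζ (homogeneous _) zetaQSym f →
      ∀ a n, ∀ x ∈ 𝒜 n, cf (Finsupp.single 0 a) (f x) = if n = a then ζ x else 0 := by
    intro f hf a n x hx
    have hfx := hf.1.2 n x hx
    split_ifs with h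
    · rw [← h, ← aeval_toPoly_of_homogeneous hfx]
      exact hf.2 x
    · exact hfx _ (by simpa using Ne.symm h)
  have hjoin : ∀ {f : H →ₗ[ℂ] QSym}, IsCombHopfMorphism 𝒜 ζ (homogeneous _) zetaQSym f →
      ∀ (N : ℕ) (m m' : ℕ →₀ ℕ), (∀ j ∈ m.support, j < N) → cf (join N m m') ∘ₗ f =
        LinearMap.mul' ℂ ℂ ∘ₗ TensorProduct.map (cf m ∘ₗ f) (cf m' ∘ₗ f) ∘ₗ
          Coalgebra.comul (R := ℂ) := by
    rintro f ⟨⟨⟨F, hF⟩, -⟩, -⟩ N m m' hm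
    -- With `f` a coalgebra map, `(f ⊗ f) ∘ Δ` becomes `Δ ∘ f`, whose coefficients are those of `f`
    -- at juxtaposed exponents.
    obtain rfl : F.toCoalgHom.toLinearMap = f := LinearMap.ext hF
    rw [TensorProduct.map_comp, LinearMap.comp_assoc, F.toCoalgHom.map_comp_comul]
    ext x
    exact (qsymData.cf₂_comulLin hm _).symm
  have key : ∀ m : ℕ →₀ ℕ, cf m ∘ₗ f = cf m ∘ₗ g := by
    intro m
    induction m using join_induction with
    | single a =>
      ext x
      have hx : x ∈ ⨆ n, 𝒜 n := h𝒜 ▸ Submodule.mem_top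
      induction hx using Submodule.iSup_induction' with
      | mem n x hx =>
        exact (hsingle hf a n x hx).trans (hsingle hg a n x hx).symm
      | zero => simp
      | add x y _ _ hx hy => rw [map_add, map_add, hx, hy]
    | join N m m' hm h h' => rw [hjoin hf N m m' hm, hjoin hg N m m' hm, h, h']
  exact LinearMap.ext fun x => invSeries_ext fun m => congrArg (fun f => f x) (key m)

theorem IsCombHopfMorphism.symToQSym_comp {𝒜 : ℕ → Submodule ℂ H} {ζ : H →ₐ[ℂ] ℂ}
    {f : H →ₗ[ℂ] SymFun} (hf : IsCombHopfMorphism 𝒜 ζ (homogeneous _) zetaSym f) :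
    IsCombHopfMorphism 𝒜 ζ (homogeneous _) zetaQSym
      ((symToQSym : SymFun →ₐ[ℂ] QSym).toLinearMap ∘ₗ f) := by
  obtain ⟨⟨⟨F, hF⟩, hdeg⟩, hζ⟩ := hf
  exact ⟨⟨⟨symToQSym.comp F, fun x => congrArg symToQSym (hF x)⟩,
    fun n x hx => hdeg n x hx⟩, fun x => hζ x⟩

theorem symToQSym_injective : Function.Injective symToQSym := fun _ _ h =>
  invSeries_ext fun m => congrArg (cf m : QSym →ₗ[ℂ] ℂ) h

/-- The inclusion of `Sym` in `QSym` is injective and respects characters, so uniqueness is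
inherited from `QSym`. -/
theorem combHopfMorphism_sym_unique {𝒜 : ℕ → Submodule ℂ H} (h𝒜 : ⨆ n, 𝒜 n = ⊤)
    {ζ : H →ₐ[ℂ] ℂ} {f g : H →ₗ[ℂ] SymFun}
    (hf : IsCombHopfMorphism 𝒜 ζ (homogeneous _) zetaSym f)
    (hg : IsCombHopfMorphism 𝒜 ζ (homogeneous _) zetaSym g) : f = g :=
  LinearMap.ext fun x => symToQSym_injective (congrArg (fun f => f x)
    (combHopfMorphism_qsym_unique h𝒜 hf.symToQSym_comp hg.symToQSym_comp))

theorem exists_isThetaQSym : ∃ Θ, IsThetaQSym Θ := by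
  obtain ⟨Θ, hΘ⟩ := exists_combHopfMorphism_qsym oddZetaQSym
  exact ⟨Θ, hΘ, fun _ hg => combHopfMorphism_qsym_unique (iSup_homogeneous qsymData) hg hΘ⟩

theorem exists_isThetaSym : ∃ Θ, IsThetaSym Θ := by
  obtain ⟨Θ, hΘ⟩ := exists_combHopfMorphism_sym oddZetaSym
  exact ⟨Θ, hΘ, fun _ hg => combHopfMorphism_sym_unique (iSup_homogeneous symData) hg hΘ⟩

end Uniqueness

/-! ### Characters and theta maps on primitive elements -/

section Primitive

variable {S : Set (ℕ ↪ ℕ)} {I : Type} [AddMonoid I]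

/-- An element `x` of a bialgebra with `Δ x = x ⊗ 1 + 1 ⊗ x`. -/
def IsPrimitive {H : Type*} [Ring H] [Bialgebra ℂ H] (x : H) : Prop :=
  Coalgebra.comul (R := ℂ) x = x ⊗ₜ[ℂ] 1 + 1 ⊗ₜ[ℂ] x

theorem IsPrimitive.map {H H' : Type*} [Ring H] [Bialgebra ℂ H] [Ring H'] [Bialgebra ℂ H']
    {x : H} (hx : IsPrimitive x) (F : H →ₐc[ℂ] H') : IsPrimitive (F x) := by
  rw [IsPrimitive, ← CoalgHomClass.map_comp_comul_apply, hx]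
  simp

theorem IsPrimitive.smul {H : Type*} [Ring H] [Bialgebra ℂ H] {x : H} (hx : IsPrimitive x)
    (c : ℂ) : IsPrimitive (c • x) := by
  rw [IsPrimitive, map_smul, hx, smul_add, TensorProduct.smul_tmul', TensorProduct.tmul_smul]

theorem IsPrimitive.counit_eq_zero {H : Type*} [Ring H] [Bialgebra ℂ H] {x : H}
    (hx : IsPrimitive x) : Coalgebra.counit (R := ℂ) x = 0 := by
  have h := congrArg (LinearMap.mul' ℂ ℂ ∘ₗ TensorProduct.map (Coalgebra.counit (R := ℂ))
    (Coalgebra.counit (R := ℂ))) hx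
  have h' : LinearMap.mul' ℂ ℂ (TensorProduct.map (Coalgebra.counit (R := ℂ))
      (Coalgebra.counit (R := ℂ)) (Coalgebra.comul (R := ℂ) x)) =
      Coalgebra.counit (R := ℂ) x := by
    -- The counit `ε` is the unit for convolution, so `1 * 1 = 1` reads `(ε ⊗ ε) Δ = ε`. Primitivity
    -- turns the left side into `2 ε(x)`, whence `ε(x) = 0`.
    have := congrArg (fun f => f x) (mul_one (1 : WithConv (H →ₗ[ℂ] ℂ)))
    exact this
  rw [LinearMap.comp_apply, h'] at h
  simpa using h

theorem convMul_of_isPrimitive {H : Type*} [Ring H] [Bialgebra ℂ H] {x : H}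
    (hx : IsPrimitive x) (ξ η : WithConv (H →ₐ[ℂ] ℂ)) : (ξ * η) x = ξ x + η x := by
  have h : (ξ * η) x = LinearMap.mul' ℂ ℂ (TensorProduct.map ξ.ofConv.toLinearMap
    η.ofConv.toLinearMap (Coalgebra.comul (R := ℂ) x)) := rfl
  rw [h, hx]
  simp

theorem convInv_of_isPrimitive {H : Type*} [CommRing H] [HopfAlgebra ℂ H] {x : H}
    (hx : IsPrimitive x) (ξ : WithConv (H →ₐ[ℂ] ℂ)) : ξ⁻¹ x = -ξ x := by
  have h := convMul_of_isPrimitive hx ξ⁻¹ ξ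
  rw [inv_mul_cancel, AlgHom.convOne_apply, hx.counit_eq_zero, map_zero] at h
  exact eq_neg_of_add_eq_zero_left h.symm

/-- On primitives convolution adds and inversion negates, and the bar contributes `(-1) ^ n`; the
value is therefore `-(-1) ^ n ζ(x) + ζ(x)`. -/
theorem oddZetaQSym_of_isPrimitive {n : ℕ} {x : QSym} (hx : IsPrimitive x)
    (hn : x ∈ homogeneous _ n) : oddZetaQSym x = (1 - (-1) ^ n) * zetaQSym x := by
  refine (convMul_of_isPrimitive hx _ _).trans ?_
  have h : (toConv (barChar ((toConv zetaQSym)⁻¹).ofConv)) x =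
      (toConv zetaQSym)⁻¹ (signHom x) := rfl
  have h' : (toConv zetaQSym)⁻¹ ((-1 : ℂ) ^ n • x) = (-1) ^ n * (toConv zetaQSym)⁻¹ x :=
    map_smul ((toConv zetaQSym)⁻¹).ofConv _ _
  rw [h, signHom_of_homogeneous hn, h', convInv_of_isPrimitive hx]
  change (-1) ^ n * -zetaQSym x + zetaQSym x = _
  ring

theorem oddZetaSym_of_isPrimitive {n : ℕ} {x : SymFun} (hx : IsPrimitive x)
    (hn : x ∈ homogeneous _ n) : oddZetaSym x = (1 - (-1) ^ n) * zetaSym x := by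
  refine (convMul_of_isPrimitive hx _ _).trans ?_
  have h : (toConv (barChar ((toConv zetaSym)⁻¹).ofConv)) x =
      (toConv zetaSym)⁻¹ (signHom x) := rfl
  have h' : (toConv zetaSym)⁻¹ ((-1 : ℂ) ^ n • x) = (-1) ^ n * (toConv zetaSym)⁻¹ x :=
    map_smul ((toConv zetaSym)⁻¹).ofConv _ _
  rw [h, signHom_of_homogeneous hn, h', convInv_of_isPrimitive hx]
  change (-1) ^ n * -zetaSym x + zetaSym x = _
  ring

/-- A homogeneous primitive series is determined by its value at `(1, 0, 0, …)`. -/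
theorem eq_of_primitive (D : TypeData S I) {n : ℕ} {f g : invSeries S}
    (hf : f ∈ homogeneous S n) (hg : g ∈ homogeneous S n)
    (hf' : D.comulLin f = f ⊗ₜ[ℂ] 1 + 1 ⊗ₜ[ℂ] f) (hg' : D.comulLin g = g ⊗ₜ[ℂ] 1 + 1 ⊗ₜ[ℂ] g)
    (h : Polynomial.aeval (1 : ℂ) (toPoly f) = Polynomial.aeval (1 : ℂ) (toPoly g)) : f = g := by
  rw [aeval_toPoly_of_homogeneous hf, aeval_toPoly_of_homogeneous hg] at h
  refine invSeries_ext fun m => ?_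
  induction m using join_induction with
  | single a =>
    by_cases ha : a = n
    · rw [ha, h]
    · rw [hf _ (by simpa using ha), hg _ (by simpa using ha)]
  | join N m m' hm ih ih' =>
    -- By primitivity the coefficient at the juxtaposition is a combination of the coefficients at
    -- `m` and `m'`, with the coefficients of `1` as weights.
    rw [← D.cf₂_comulLin hm, ← D.cf₂_comulLin hm, hf', hg', map_add, map_add]
    simp only [cf₂_tmul, ih, ih']

/-- Both sides are primitive of degree `n`, and they have the same value under `zetaQSym`, so
`eq_of_primitive` applies. -/
theorem theta_qsym_of_isPrimitive {Θ : QSym →ₗ[ℂ] QSym} (hΘ : IsThetaQSym Θ) {n : ℕ} {x : QSym}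
    (hx : IsPrimitive x) (hn : x ∈ homogeneous _ n) : Θ x = (1 - (-1) ^ n : ℂ) • x := by
  obtain ⟨⟨⟨⟨F, hF⟩, hdeg⟩, hζ⟩, -⟩ := hΘ
  refine eq_of_primitive qsymData (hdeg n x hn) (Submodule.smul_mem _ _ hn)
    (hF x ▸ hx.map F) (hx.smul _) ?_
  refine (hζ x).trans ((oddZetaQSym_of_isPrimitive hx hn).trans ?_)
  exact (map_smul zetaQSym _ x).symm

theorem theta_sym_of_isPrimitive {Θ : SymFun →ₗ[ℂ] SymFun} (hΘ : IsThetaSym Θ) {n : ℕ}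
    {x : SymFun} (hx : IsPrimitive x) (hn : x ∈ homogeneous _ n) :
    Θ x = (1 - (-1) ^ n : ℂ) • x := by
  obtain ⟨⟨⟨⟨F, hF⟩, hdeg⟩, hζ⟩, -⟩ := hΘ
  refine eq_of_primitive symData (hdeg n x hn) (Submodule.smul_mem _ _ hn)
    (hF x ▸ hx.map F) (hx.smul _) ?_
  refine (hζ x).trans ((oddZetaSym_of_isPrimitive hx hn).trans ?_)
  exact (map_smul zetaSym _ x).symm

theorem powerSum_eq_mono (k : ℕ+) : powerSum k = symData.mono {k} := by
  classical
  refine invSeries_ext fun m => ?_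
  rw [symData.cf_mono]
  change (if ∃ i, m = Finsupp.single i (k : ℕ) then (1 : ℂ) else 0) = _
  have h : (∃ i, m = Finsupp.single i (k : ℕ)) ↔ symData.typ m = {k} := by
    constructor
    · rintro ⟨i, rfl⟩
      -- The power of the variable with index `i` is a translate of the power of the first variable.
      have : Finsupp.single i (k : ℕ) =
          (Finsupp.single 0 (k : ℕ)).embDomain (addRightEmbedding i) := by
        rw [Finsupp.embDomain_single]
        simp
      rw [this, symData.typ_embDomain _ trivial, symData_typ_single]
    · intro h
      rw [← symData_typ_single] at h
      obtain ⟨φ, -, ψ, -, p, rfl, hp⟩ := symData.exists_common _ _ h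
      obtain ⟨x, hx, -⟩ := Finsupp.single_of_embDomain_single p ψ 0 (k : ℕ) k.ne_zero hp.symm
      exact ⟨φ x, by rw [hx, Finsupp.embDomain_single]⟩
  by_cases h' : symData.typ m = {k}
  · rw [if_pos (h.mpr h'), if_pos h']
  · rw [if_neg (mt h.mp h'), if_neg h']

/-- A partition with a single part can only be cut trivially, so the coproduct has just the two
extreme terms. -/
theorem isPrimitive_powerSum (k : ℕ+) : IsPrimitive (powerSum k) := by
  classical
  rw [powerSum_eq_mono]
  refine (symData.comulLin_mono _).trans ?_
  have h : symData.cuts {k} = {({k}, 0), (0, {k})} := by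
    ext ⟨μ, ν⟩
    simp only [TypeData.mem_cuts, Finset.mem_insert, Finset.mem_singleton, Prod.mk.injEq]
    refine ⟨fun h => ?_, ?_⟩
    · rcases Multiset.le_singleton.mp (h ▸ Multiset.le_add_right μ ν) with rfl | rfl
      · exact Or.inr ⟨rfl, by rwa [zero_add] at h⟩
      · exact Or.inl ⟨rfl, add_eq_left.mp h⟩
    · rintro (⟨rfl, rfl⟩ | ⟨rfl, rfl⟩)
      · exact add_zero _
      · exact zero_add _
  rw [h, Finset.sum_pair (by simp), symData.mono_zero]

theorem isPrimitive_scaledPowerSum {n : ℕ} (hn : 0 < n) : IsPrimitive (scaledPowerSum n) :=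
  (isPrimitive_powerSum ⟨n, hn⟩).smul _

theorem scaledPowerSum_mem_homogeneous (n : ℕ) : scaledPowerSum n ∈ homogeneous _ n := by
  refine Submodule.smul_mem _ _ fun m hm => if_neg ?_
  rintro ⟨i, rfl⟩
  simp at hm

end Primitive

/-! ### The grading of the tensor algebra by words -/

section Words

variable {I V : Type*} [AddCommGroup V] [Module ℂ V] (b : Module.Basis I ℂ V) (deg : I → ℕ)

theorem word_nil : word b [] = 1 := rfl

theorem word_cons (i : I) (w : List I) :
    word b (i :: w) = TensorAlgebra.ι ℂ (b i) * word b w := by simp [word]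

theorem word_append (w w' : List I) : word b (w ++ w') = word b w * word b w' := by simp [word]

theorem tensorAlgebra_basis_ofList (w : List I) :
    b.tensorAlgebra (FreeMonoid.ofList w) = word b w :=
  tensorAlgebra_basis_apply b (FreeMonoid.ofList w)

theorem word_mem_tensorGrading (w : List I) :
    word b w ∈ tensorGrading b deg (w.map deg).sum :=
  Submodule.subset_span ⟨w, rfl, rfl⟩

theorem ι_basis_mem_tensorGrading (i : I) :
    TensorAlgebra.ι ℂ (b i) ∈ tensorGrading b deg (deg i) := by
  simpa [word] using word_mem_tensorGrading b deg [i]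

theorem tensorGrading_eq_span_image (n : ℕ) : tensorGrading b deg n =
    Submodule.span ℂ (b.tensorAlgebra '' {w | (w.toList.map deg).sum = n}) := by
  refine congrArg (Submodule.span ℂ) (Set.ext fun x => ⟨?_, ?_⟩)
  · rintro ⟨w, hw, rfl⟩
    exact ⟨FreeMonoid.ofList w, hw, tensorAlgebra_basis_ofList b w⟩
  · rintro ⟨w, hw, rfl⟩
    exact ⟨w.toList, hw, tensorAlgebra_basis_apply b w⟩

theorem iSup_tensorGrading : ⨆ n, tensorGrading b deg n = ⊤ := by
  rw [eq_top_iff, ← b.tensorAlgebra.span_eq, Submodule.span_le]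
  rintro _ ⟨w, rfl⟩
  rw [tensorAlgebra_basis_apply]
  exact Submodule.mem_iSup_of_mem _ (word_mem_tensorGrading b deg w.toList)

theorem isInternal_tensorGrading : DirectSum.IsInternal (tensorGrading b deg) := by
  refine DirectSum.isInternal_submodule_of_iSupIndep_of_iSup_eq_top (fun n => ?_)
    (iSup_tensorGrading b deg)
  -- The other components together lie in the span of the words of degree different from `n`;
  -- disjoint sets of basis vectors have disjoint spans.
  refine Disjoint.mono_right (c := Submodule.span ℂ
    (b.tensorAlgebra '' {w | (w.toList.map deg).sum ≠ n})) ?_ ?_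
  · refine iSup₂_le fun k hk => ?_
    rw [tensorGrading_eq_span_image]
    refine Submodule.span_mono (Set.image_mono fun w hw => ?_)
    exact fun h => hk (hw.symm.trans h)
  · rw [tensorGrading_eq_span_image]
    exact b.tensorAlgebra.linearIndependent.disjoint_span_image
      (Set.disjoint_left.mpr fun w h h' => h' h)

theorem one_mem_tensorGrading : (1 : TensorAlgebra ℂ V) ∈ tensorGrading b deg 0 :=
  word_mem_tensorGrading b deg []

theorem mul_mem_tensorGrading {i j : ℕ} {x y : TensorAlgebra ℂ V}
    (hx : x ∈ tensorGrading b deg i) (hy : y ∈ tensorGrading b deg j) :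
    x * y ∈ tensorGrading b deg (i + j) := by
  have h := Submodule.mul_mem_mul hx hy
  rw [tensorGrading, tensorGrading, Submodule.span_mul_span] at h
  refine Submodule.span_mono ?_ h
  rintro _ ⟨_, ⟨w, rfl, rfl⟩, _, ⟨w', rfl, rfl⟩, rfl⟩
  exact ⟨w ++ w', by simp, (word_append b w w').symm⟩

/-- The component of degree `n` of the tensor square of the tensor algebra. -/
def tensorSquareGrading (n : ℕ) : Submodule ℂ (TensorAlgebra ℂ V ⊗[ℂ] TensorAlgebra ℂ V) :=
  ⨆ p ∈ Finset.HasAntidiagonal.antidiagonal n, LinearMap.range (TensorProduct.map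
    (tensorGrading b deg p.1).subtype (tensorGrading b deg p.2).subtype)

theorem tmul_mem_tensorSquareGrading {i j : ℕ} {x y : TensorAlgebra ℂ V}
    (hx : x ∈ tensorGrading b deg i) (hy : y ∈ tensorGrading b deg j) :
    x ⊗ₜ[ℂ] y ∈ tensorSquareGrading b deg (i + j) :=
  Submodule.mem_iSup_of_mem (i, j) (Submodule.mem_iSup_of_mem
    (Finset.HasAntidiagonal.mem_antidiagonal.mpr rfl) ⟨⟨x, hx⟩ ⊗ₜ ⟨y, hy⟩, rfl⟩)

theorem tensorSquareGrading_le {n : ℕ}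
    {P : Submodule ℂ (TensorAlgebra ℂ V ⊗[ℂ] TensorAlgebra ℂ V)}
    (h : ∀ i j, i + j = n → ∀ x ∈ tensorGrading b deg i, ∀ y ∈ tensorGrading b deg j,
      x ⊗ₜ[ℂ] y ∈ P) : tensorSquareGrading b deg n ≤ P := by
  refine iSup₂_le fun p hp => ?_
  rintro _ ⟨X, rfl⟩
  induction X using TensorProduct.induction_on with
  | zero => rw [map_zero]; exact P.zero_mem
  | add X Y hX hY => rw [map_add]; exact P.add_mem hX hY
  | tmul x y =>
    exact h _ _ (Finset.HasAntidiagonal.mem_antidiagonal.mp hp) _ x.2 _ y.2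

theorem mul_mem_tensorSquareGrading {i j n : ℕ} {x y : TensorAlgebra ℂ V}
    {X : TensorAlgebra ℂ V ⊗[ℂ] TensorAlgebra ℂ V} (hx : x ∈ tensorGrading b deg i)
    (hy : y ∈ tensorGrading b deg j) (hX : X ∈ tensorSquareGrading b deg n) :
    x ⊗ₜ[ℂ] y * X ∈ tensorSquareGrading b deg (i + j + n) := by
  refine tensorSquareGrading_le b deg (P := (tensorSquareGrading b deg (i + j + n)).comap
    (LinearMap.mulLeft ℂ (x ⊗ₜ[ℂ] y))) ?_ hX
  rintro k l rfl u hu v hv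
  rw [Submodule.mem_comap, LinearMap.mulLeft_apply, Algebra.TensorProduct.tmul_mul_tmul,
    add_add_add_comm]
  exact tmul_mem_tensorSquareGrading b deg (mul_mem_tensorGrading b deg hx hu)
    (mul_mem_tensorGrading b deg hy hv)

theorem comul_word_mem (w : List I) : Coalgebra.comul (R := ℂ) (word b w) ∈
    tensorSquareGrading b deg (w.map deg).sum := by
  induction w with
  | nil =>
    rw [word_nil, Bialgebra.comul_one, Algebra.TensorProduct.one_def]
    exact tmul_mem_tensorSquareGrading b deg (i := 0) (j := 0) (one_mem_tensorGrading b deg)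
      (one_mem_tensorGrading b deg)
  | cons i w ih =>
    rw [word_cons, Bialgebra.comul_mul, comul_ι, add_mul, List.map_cons, List.sum_cons]
    refine Submodule.add_mem _ ?_ ?_
    · have := mul_mem_tensorSquareGrading b deg (ι_basis_mem_tensorGrading b deg i)
        (one_mem_tensorGrading b deg) ih
      rwa [add_zero] at this
    · have := mul_mem_tensorSquareGrading b deg (one_mem_tensorGrading b deg)
        (ι_basis_mem_tensorGrading b deg i) ih
      rwa [zero_add] at this

theorem tensorGrading_le {n : ℕ} {P : Submodule ℂ (TensorAlgebra ℂ V)}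
    (h : ∀ w : List I, (w.map deg).sum = n → word b w ∈ P) : tensorGrading b deg n ≤ P := by
  refine Submodule.span_le.mpr ?_
  rintro _ ⟨w, hw, rfl⟩
  exact h w hw

theorem tensorAntipode_word_mem (w : List I) :
    tensorAntipode (word b w) ∈ tensorGrading b deg (w.map deg).sum := by
  induction w with
  | nil =>
    rw [word_nil, tensorAntipode_one]
    exact one_mem_tensorGrading b deg
  | cons i w ih =>
    rw [word_cons, tensorAntipode_mul, tensorAntipode_ι, List.map_cons, List.sum_cons, add_comm]
    exact mul_mem_tensorGrading b deg ih
      (Submodule.neg_mem _ (ι_basis_mem_tensorGrading b deg i))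

/-- A letter of degree `0` could be repeated arbitrarily often, giving infinitely many words of
degree `0`. Positivity serves for connectedness and for the primitivity of the power sums. -/
theorem deg_pos_of_finite_words (hfin : {w : List I | (w.map deg).sum = 0}.Finite) (i : I) :
    0 < deg i := by
  by_contra h
  refine Set.infinite_of_injective_forall_mem (f := fun n => List.replicate n i)
    (List.replicate_left_injective i) (fun n => ?_) hfin
  simp only [Set.mem_ofPred_eq, List.map_replicate, List.sum_replicate]
  rw [Nat.eq_zero_of_not_pos h, smul_zero]

theorem isGradedConnectedHopf_tensorGrading (hdeg : ∀ i, 0 < deg i) :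
    IsGradedConnectedHopf (tensorGrading b deg) where
  isInternal := isInternal_tensorGrading b deg
  one_mem := one_mem_tensorGrading b deg
  mul_mem _ _ _ ha _ hb := mul_mem_tensorGrading b deg ha hb
  comul_mem n a ha := tensorGrading_le b deg
    (P := (tensorSquareGrading b deg n).comap Coalgebra.comul)
    (by rintro w rfl; exact comul_word_mem b deg w) ha
  counit_eq_zero n hn a ha := tensorGrading_le b deg
    (P := LinearMap.ker (Coalgebra.counit (R := ℂ) (A := TensorAlgebra ℂ V))) (by
      rintro (_ | ⟨i, w⟩) rfl
      · exact absurd rfl hn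
      · rw [LinearMap.mem_ker, word_cons, Bialgebra.counit_mul, counit_ι, zero_mul]) ha
  antipode_mem n a ha := tensorGrading_le b deg
    (P := (tensorGrading b deg n).comap (HopfAlgebra.antipode ℂ))
    (by rintro w rfl; exact tensorAntipode_word_mem b deg w) ha
  connected := by
    refine le_antisymm (tensorGrading_le b deg fun w hw => ?_) ?_
    · rcases w with _ | ⟨i, w⟩
      · exact Submodule.subset_span rfl
      · have := hdeg i
        rw [List.map_cons, List.sum_cons] at hw
        omega
    · rw [Submodule.span_singleton_le_iff_mem]
      exact one_mem_tensorGrading b deg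

end Words

/-! ### Morphisms on the tensor algebra determined by generators -/

section Morphisms

variable {I V : Type*} [AddCommGroup V] [Module ℂ V] (b : Module.Basis I ℂ V) (deg : I → ℕ)

theorem algHom_tensor_ext {A : Type*} [Semiring A] [Algebra ℂ A]
    {f g : TensorAlgebra ℂ V →ₐ[ℂ] A}
    (h : ∀ i, f (TensorAlgebra.ι ℂ (b i)) = g (TensorAlgebra.ι ℂ (b i))) : f = g :=
  TensorAlgebra.hom_ext (b.ext h)

/-- An algebra morphism on the tensor algebra which maps the generators to homogeneous primitive
elements of the right degree is a graded Hopf morphism. -/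
theorem isGradedHopfMorphism_of_primitive {H : Type*} [Ring H] [HopfAlgebra ℂ H]
    {ℬ : ℕ → Submodule ℂ H} (hone : 1 ∈ ℬ 0)
    (hmul : ∀ i j, ∀ x ∈ ℬ i, ∀ y ∈ ℬ j, x * y ∈ ℬ (i + j))
    (f : TensorAlgebra ℂ V →ₐ[ℂ] H) (hf : ∀ i, IsPrimitive (f (TensorAlgebra.ι ℂ (b i))))
    (hf' : ∀ i, f (TensorAlgebra.ι ℂ (b i)) ∈ ℬ (deg i)) :
    IsGradedHopfMorphism (tensorGrading b deg) ℬ f.toLinearMap := by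
  refine ⟨⟨BialgHom.ofAlgHom f (algHom_tensor_ext b fun i => ?_)
    (algHom_tensor_ext b fun i => ?_), fun _ => rfl⟩, fun n x hx => ?_⟩
  · exact (hf i).counit_eq_zero.trans (counit_ι _).symm
  · refine Eq.trans ?_ (hf i).symm
    change Algebra.TensorProduct.map f f (Coalgebra.comul (R := ℂ) (TensorAlgebra.ι ℂ (b i))) = _
    rw [comul_ι, map_add, Algebra.TensorProduct.map_tmul, Algebra.TensorProduct.map_tmul, map_one]
  · refine tensorGrading_le b deg (P := (ℬ n).comap f.toLinearMap) ?_ hx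
    clear hx
    rintro w rfl
    rw [Submodule.mem_comap, AlgHom.toLinearMap_apply]
    induction w with
    | nil =>
      rw [word_nil, map_one]
      exact hone
    | cons i w ih =>
      rw [word_cons, map_mul]
      exact hmul _ _ _ (hf' i) _ ih

theorem phiTensor_ι (i : I) :
    phiTensor b deg (TensorAlgebra.ι ℂ (b i)) = scaledPowerSum (deg i) := by
  rw [phiTensor, TensorAlgebra.lift_ι_apply, Module.Basis.constr_basis]

theorem isGradedHopfMorphism_phiTensor (hdeg : ∀ i, 0 < deg i) :
    IsGradedHopfMorphism (tensorGrading b deg) (homogeneous _) (phiTensor b deg).toLinearMap := by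
  have hmul : ∀ i j, ∀ x ∈ homogeneous (Set.univ : Set (ℕ ↪ ℕ)) i,
      ∀ y ∈ homogeneous (Set.univ : Set (ℕ ↪ ℕ)) j, x * y ∈ homogeneous _ (i + j) :=
    fun i j x hx y hy => mul_mem_homogeneous hx hy
  refine isGradedHopfMorphism_of_primitive b deg one_mem_homogeneous
    hmul _ (fun i => ?_) (fun i => ?_)
  · rw [phiTensor_ι]
    exact isPrimitive_scaledPowerSum (hdeg i)
  · rw [phiTensor_ι]
    exact scaledPowerSum_mem_homogeneous _

/-- The map `Θ_{T(V)}` as a morphism of algebras. -/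
def thetaTensorHom : TensorAlgebra ℂ V →ₐ[ℂ] TensorAlgebra ℂ V :=
  TensorAlgebra.lift ℂ (b.constr ℂ fun i => (1 - (-1) ^ deg i : ℂ) • TensorAlgebra.ι ℂ (b i))

theorem thetaTensorHom_ι (i : I) : thetaTensorHom b deg (TensorAlgebra.ι ℂ (b i)) =
    (1 - (-1) ^ deg i : ℂ) • TensorAlgebra.ι ℂ (b i) := by
  rw [thetaTensorHom, TensorAlgebra.lift_ι_apply, Module.Basis.constr_basis]

theorem one_sub_neg_one_pow_of_odd {n : ℕ} (h : Odd n) : (1 - (-1) ^ n : ℂ) = 2 := by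
  rw [h.neg_one_pow]
  norm_num

/-- A word picks up one factor `1 - (-1) ^ deg i` per letter: a single even letter kills it, and
otherwise the factors multiply to `2` to the length. This is why the map given by cases on words is
multiplicative. -/
theorem thetaTensorHom_word (w : List I) :
    thetaTensorHom b deg (word b w) = thetaTensor b deg (word b w) := by
  classical
  rw [thetaTensor_word]
  induction w with
  | nil => simp [word_nil]
  | cons i w ih =>
    rw [word_cons, map_mul, ih, thetaTensorHom_ι]
    rcases Nat.even_or_odd (deg i) with h | h
    · rw [h.neg_one_pow, sub_self, zero_smul, zero_mul, if_neg]
      exact fun h' => Nat.not_odd_iff_even.mpr h (h' i List.mem_cons_self)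
    · rw [one_sub_neg_one_pow_of_odd h]
      by_cases h' : ∀ j ∈ w, Odd (deg j)
      · rw [if_pos h', if_pos (List.forall_mem_cons (p := fun j => Odd (deg j)) |>.mpr ⟨h, h'⟩), List.length_cons, pow_succ',
          smul_mul_smul_comm]
      · rw [if_neg h', if_neg fun h'' => h' fun j hj => h'' j (List.mem_cons_of_mem _ hj), mul_zero]

theorem toLinearMap_thetaTensorHom : (thetaTensorHom b deg).toLinearMap = thetaTensor b deg :=
  b.tensorAlgebra.ext fun w => by
    rw [tensorAlgebra_basis_apply]
    exact thetaTensorHom_word b deg w.toList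

theorem isGradedHopfMorphism_thetaTensor :
    IsGradedHopfMorphism (tensorGrading b deg) (tensorGrading b deg) (thetaTensor b deg) := by
  rw [← toLinearMap_thetaTensorHom]
  refine isGradedHopfMorphism_of_primitive b deg (one_mem_tensorGrading b deg)
    (fun _ _ _ hx _ hy => mul_mem_tensorGrading b deg hx hy) _ (fun i => ?_) (fun i => ?_)
  · rw [thetaTensorHom_ι]
    exact IsPrimitive.smul (comul_ι (b i)) _
  · rw [thetaTensorHom_ι]
    exact Submodule.smul_mem _ _ (ι_basis_mem_tensorGrading b deg i)

theorem range_thetaTensor :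
    LinearMap.range (thetaTensor b deg) = Subalgebra.toSubmodule (tensorOdd b deg) := by
  classical
  have hι : ∀ i, Odd (deg i) → TensorAlgebra.ι ℂ (b i) ∈ tensorOdd b deg := fun i hi =>
    ⟨TensorAlgebra.ι ℂ ⟨b i, Submodule.subset_span ⟨i, hi, rfl⟩⟩,
      TensorAlgebra.lift_ι_apply _ _⟩
  refine le_antisymm ?_ ?_
  · rw [LinearMap.range_eq_map, ← b.tensorAlgebra.span_eq, Submodule.map_span_le]
    rintro _ ⟨w, rfl⟩
    rw [tensorAlgebra_basis_apply, thetaTensor_word]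
    split_ifs with h
    · refine Submodule.smul_mem _ _ (show word b w.toList ∈ tensorOdd b deg from
        list_prod_mem fun x hx => ?_)
      obtain ⟨i, hi, rfl⟩ := List.mem_map.mp hx
      exact hι i (h i hi)
    · exact Submodule.zero_mem _
  · rw [← toLinearMap_thetaTensorHom]
    change tensorOdd b deg ≤ (thetaTensorHom b deg).range
    rintro _ ⟨x, rfl⟩
    change TensorAlgebra.lift ℂ (TensorAlgebra.ι ℂ ∘ₗ (oddSubspace b deg).subtype) x ∈ _
    induction x using TensorAlgebra.induction with
    | algebraMap r =>
      rw [AlgHom.commutes]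
      exact Subalgebra.algebraMap_mem _ r
    | ι x =>
      rw [TensorAlgebra.lift_ι_apply]
      have hle : oddSubspace b deg ≤
          (Subalgebra.toSubmodule (thetaTensorHom b deg).range).comap (TensorAlgebra.ι ℂ) := by
        refine Submodule.span_le.mpr ?_
        rintro _ ⟨i, hi, rfl⟩
        -- Odd generators are doubled, so half of a generator is a preimage of it. As the range is a
        -- subalgebra, this suffices for all of `T(O(V))`.
        refine ⟨(2⁻¹ : ℂ) • TensorAlgebra.ι ℂ (b i), ?_⟩
        change thetaTensorHom b deg _ = _
        rw [map_smul, thetaTensorHom_ι, one_sub_neg_one_pow_of_odd hi, smul_smul,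
          inv_mul_cancel₀ two_ne_zero, one_smul]
      exact hle x.2
    | mul x y hx hy =>
      rw [map_mul]
      exact mul_mem hx hy
    | add x y hx hy =>
      rw [map_add]
      exact add_mem hx hy

/-- An algebra morphism on `T(V)` intertwines `Θ_{T(V)}` with every bialgebra morphism that rescales
the images of the generators in the same way. -/
theorem comp_thetaTensor_eq {H : Type*} [Ring H] [HopfAlgebra ℂ H]
    (Φ : TensorAlgebra ℂ V →ₐ[ℂ] H) {Θ : H →ₗ[ℂ] H} (hΘ : ∃ F : H →ₐc[ℂ] H, ∀ x, F x = Θ x)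
    (h : ∀ i, Θ (Φ (TensorAlgebra.ι ℂ (b i))) =
      (1 - (-1) ^ deg i : ℂ) • Φ (TensorAlgebra.ι ℂ (b i))) :
    Φ.toLinearMap ∘ₗ thetaTensor b deg = Θ ∘ₗ Φ.toLinearMap := by
  obtain ⟨F, hF⟩ := hΘ
  -- Both composites are algebra morphisms on a free algebra, so only generators need to be
  -- compared.
  have key : Φ.comp (thetaTensorHom b deg) = (F : H →ₐ[ℂ] H).comp Φ :=
    algHom_tensor_ext b fun i => by
      rw [AlgHom.comp_apply, thetaTensorHom_ι, map_smul, ← h i]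
      exact (hF _).symm
  rw [← toLinearMap_thetaTensorHom]
  ext1 x
  exact (congrArg (fun f => f x) key).trans (hF _)

end Morphisms

end PeakAlgebra

end

/-! ### The theorem -/

theorem mainTheorem5 {I V : Type*} [AddCommGroup V] [Module ℂ V] (b : Module.Basis I ℂ V)
    (deg : I → ℕ) (hfin : ∀ n : ℕ, {w : List I | (w.map deg).sum = n}.Finite) :
    PeakAlgebra.IsGradedHopfMorphism (PeakAlgebra.tensorGrading b deg)
      (PeakAlgebra.homogeneous _) (PeakAlgebra.phiTensor b deg).toLinearMap ∧
    PeakAlgebra.IsGradedHopfMorphism (PeakAlgebra.tensorGrading b deg)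
      (PeakAlgebra.tensorGrading b deg) (PeakAlgebra.thetaTensor b deg) ∧
    (∃ ΘSym : PeakAlgebra.SymFun →ₗ[ℂ] PeakAlgebra.SymFun,
      PeakAlgebra.IsThetaSym ΘSym ∧
      (PeakAlgebra.phiTensor b deg).toLinearMap ∘ₗ PeakAlgebra.thetaTensor b deg =
        ΘSym ∘ₗ (PeakAlgebra.phiTensor b deg).toLinearMap ∧
      (Subalgebra.toSubmodule (PeakAlgebra.tensorOdd b deg)).map
        (PeakAlgebra.phiTensor b deg).toLinearMap ≤ LinearMap.range ΘSym) ∧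
    PeakAlgebra.IsThetaMap (PeakAlgebra.tensorGrading b deg) (PeakAlgebra.zetaTensor b deg)
      (PeakAlgebra.thetaTensor b deg) ∧
    LinearMap.range (PeakAlgebra.thetaTensor b deg) =
      Subalgebra.toSubmodule (PeakAlgebra.tensorOdd b deg) := by
  open PeakAlgebra in
  have hdeg := deg_pos_of_finite_words deg (hfin 0)
  have hΦ := isGradedHopfMorphism_phiTensor b deg hdeg
  refine ⟨hΦ, isGradedHopfMorphism_thetaTensor b deg, ?_, ?_, range_thetaTensor b deg⟩
  · obtain ⟨ΘS, hΘS⟩ := exists_isThetaSym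
    have hcomm := comp_thetaTensor_eq b deg (phiTensor b deg) hΘS.1.1.1 fun i => by
      rw [phiTensor_ι]
      exact theta_sym_of_isPrimitive hΘS (isPrimitive_scaledPowerSum (hdeg i))
        (scaledPowerSum_mem_homogeneous _)
    refine ⟨ΘS, hΘS, hcomm, ?_⟩
    -- As `T(O(V))` is the image of `Θ_{T(V)}`, its image under `Φ_{T(V)}` is that of `Θ_Sym ∘
    -- Φ_{T(V)}`, hence lies in `Ω`.
    rw [← range_thetaTensor, ← LinearMap.range_comp, hcomm]
    exact LinearMap.range_comp_le_range _ _
  · obtain ⟨ΘQ, hΘQ⟩ := exists_isThetaQSym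
    -- The universal morphism to `QSym` is `Φ_{T(V)}` followed by the inclusion of `Sym`. Its values
    -- on generators are again homogeneous primitives, so the argument for `Sym` repeats with
    -- `Θ_QSym`.
    have hΦQ : IsCombHopfMorphism (tensorGrading b deg) (zetaTensor b deg) (homogeneous _)
        zetaQSym ((symToQSym : SymFun →ₐ[ℂ] QSym).comp (phiTensor b deg)).toLinearMap :=
      IsCombHopfMorphism.symToQSym_comp (f := (phiTensor b deg).toLinearMap) ⟨hΦ, fun _ => rfl⟩
    refine ⟨isGradedConnectedHopf_tensorGrading b deg hdeg, _, ΘQ, ⟨hΦQ, fun g hg =>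
      combHopfMorphism_qsym_unique (iSup_tensorGrading b deg) hg hΦQ⟩, hΘQ, ?_⟩
    refine comp_thetaTensor_eq b deg _ hΘQ.1.1.1 fun i => ?_
    rw [AlgHom.comp_apply, phiTensor_ι]
    exact theta_qsym_of_isPrimitive hΘQ ((isPrimitive_scaledPowerSum (hdeg i)).map symToQSym)
      (scaledPowerSum_mem_homogeneous (deg i))
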